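/- Let $k\ge 1$. For each $n\ge 1$ let $X_1,\dots,X_k$ (depending on $n$) be independent random $n\times n$ matrices which either are all GUEs or are all Ginibre ensembles. Here a GUE is a random Hermitian matrix $S$ whose entries $S_{ii}$, $\sqrt2\,\mathrm{Re}\,S_{ij}$, $\sqrt2\,\mathrm{Im}\,S_{ij}$ ($i<j$) are i.i.d. with law $N(0,1/n)$, and Ginibre ensembles are given by $C_i=(S_i+\sqrt{-1}\,S_i')/\sqrt2$, where $S_1,\dots,S_k,S_1',\dots,S_k'$ are independent GUEs. All these matrices, for all $n$, live on one probability space; no assumption is made on their joint law for different $n$. On $n\times n$ complex matrices define $$\Phi_n(\rho)=\frac1k\sum_{i=1}^k X_i\rho X_i^*,\qquad \Phi_n^c(\rho)=\frac1k\sum_{i,j=1}^k \mathrm{Tr}[X_i\rho X_j^*]\,|i\rangle\langle j|,$$ and let $\bar\Phi_n,\bar\Phi_n^c$ be the maps obtained by replacing each $X_i$ by its entrywise complex conjugate $\bar X_i$. For $m\ge1$ let $|b_m\rangle=\frac1{\sqrt m}\sum_{i=1}^m|i\rangle\otimes|i\rangle$ be the Bell state in $\mathbb C^m\otimes\mathbb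 C^m$. For $1\le p\le\infty$ let $\|\Phi\|_p=\max_\rho\|\Phi(\rho)\|_p$, where $\|\cdot\|_p$ on matrices is the Schatten $p$-norm and $\rho$ runs over the positive semidefinite matrices of trace one. Then, almost surely, $$\lim_{n\to\infty}(\Phi_n^c\otimes\bar\Phi_n^c)(|b_n\rangle\langle b_n|)=\frac1{k^2}I_{k^2}+\frac1k|b_k\rangle\langle b_k|,$$ and, for all $1\le p\le\infty$, $$\liminf_{n\to\infty}\|\Phi_n\otimes\bar\Phi_n\|_p=\liminf_{n\to\infty}\|\Phi_n^c\otimes\bar\Phi_n^c\|_p\ \ge\ \left(\left(\frac1k+\frac1{k^2}\right)^p+(k^2-1)\left(\frac1{k^2}\right)^p\right)^{1/p},$$ where for $p=\infty$ the right-hand side is read as $\frac1k+\frac1{k^2}$. -/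

import Mathlib

open MeasureTheory ProbabilityTheory Filter Topology
open scoped ENNReal NNReal Matrix Kronecker ComplexConjugate ComplexOrder

/-- The `n ^ 2` real coordinates of a Hermitian matrix `S`: the diagonal entries, `√2 * Re S i j`
for `i < j`, and (at the index `(j, i)`, again for `i < j`) `√2 * Im S i j`. -/
noncomputable def gueCoord {n : ℕ} (S : Matrix (Fin n) (Fin n) ℂ) (e : Fin n × Fin n) : ℝ :=
  if e.1 = e.2 then (S e.1 e.1).re
  else if e.1 < e.2 then √2 * (S e.1 e.2).re
  else √2 * (S e.2 e.1).im

/-- `S` is a family of independent `n × n` Gaussian unitary ensembles: each `S i` is almost surely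
Hermitian, and the real coordinates of all the matrices together are independent with the
law `N(0, 1 / n)`. -/
structure IsGUEFamily {Ω ι : Type*} [MeasurableSpace Ω] {n : ℕ}
    (S : ι → Ω → Matrix (Fin n) (Fin n) ℂ) (P : Measure Ω) : Prop where
  isHermitian : ∀ i, ∀ᵐ ω ∂P, (S i ω).IsHermitian
  hasLaw : ∀ i e, HasLaw (fun ω => gueCoord (S i ω) e) (gaussianReal 0 ((n : ℝ≥0)⁻¹)) P
  indep : iIndepFun (fun (x : ι × (Fin n × Fin n)) ω => gueCoord (S x.1 ω) x.2) P

/-- `C` is a family of independent `n × n` Ginibre ensembles: `C i = (S i + √-1 S' i) / √2`, where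
the `S i` and the `S' i` together form a family of independent GUEs. -/
def IsGinibreFamily {Ω ι : Type*} [MeasurableSpace Ω] {n : ℕ}
    (C : ι → Ω → Matrix (Fin n) (Fin n) ℂ) (P : Measure Ω) : Prop :=
  ∃ S : ι ⊕ ι → Ω → Matrix (Fin n) (Fin n) ℂ, IsGUEFamily S P ∧
    ∀ i ω, C i ω = ((√2 : ℝ) : ℂ)⁻¹ • (S (Sum.inl i) ω + Complex.I • S (Sum.inr i) ω)

/-- The map `Φ ρ = (1 / k) ∑ i, X i * ρ * (X i)ᴴ` attached to `X 1, …, X k`. -/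
noncomputable def cpMap {k : ℕ} {m : Type*} [Fintype m] (X : Fin k → Matrix m m ℂ) :
    Matrix m m ℂ →ₗ[ℂ] Matrix m m ℂ where
  toFun ρ := (k : ℂ)⁻¹ • ∑ i, X i * ρ * (X i)ᴴ
  map_add' ρ σ := by
    simp [Matrix.mul_add, Matrix.add_mul, Finset.sum_add_distrib]
  map_smul' c ρ := by
    simp [← Finset.smul_sum, smul_comm c]

/-- The complementary map `Φᶜ ρ = (1 / k) ∑ i j, Tr (X i * ρ * (X j)ᴴ) |i⟩⟨j|`: the complement of
`cpMap X`, whose Kraus operators are the `X i / √k`. -/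
noncomputable def complMap {k : ℕ} {m : Type*} [Fintype m] (X : Fin k → Matrix m m ℂ) :
    Matrix m m ℂ →ₗ[ℂ] Matrix (Fin k) (Fin k) ℂ where
  toFun ρ := (k : ℂ)⁻¹ • Matrix.of fun i j => (X i * ρ * (X j)ᴴ).trace
  map_add' ρ σ := by
    ext i j
    simp [Matrix.add_mul, _root_.mul_add]
  map_smul' c ρ := by
    ext i j
    simp [mul_left_comm]

/-- The entrywise complex conjugates of the matrices `X 1, …, X k`. The maps `cpMap (conjFam X)`
and `complMap (conjFam X)` are the complex conjugates of `cpMap X` and `complMap X`. -/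
noncomputable def conjFam {k : ℕ} {m : Type*} (X : Fin k → Matrix m m ℂ) :
    Fin k → Matrix m m ℂ :=
  fun i => (X i).map conj

/-- The tensor product of two linear maps between matrix spaces, with `M_a ⊗ M_b` realised as the
matrices indexed by pairs: the linear map with `A ⊗ B ↦ Φ A ⊗ Ψ B`. -/
noncomputable def tensorMap {a b c d : Type*} [Fintype a] [DecidableEq a] [Fintype b]
    [DecidableEq b] (Φ : Matrix a a ℂ →ₗ[ℂ] Matrix c c ℂ) (Ψ : Matrix b b ℂ →ₗ[ℂ] Matrix d d ℂ) :
    Matrix (a × b) (a × b) ℂ →ₗ[ℂ] Matrix (c × d) (c × d) ℂ where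
  toFun ρ := ∑ x : a × b, ∑ y : a × b,
    ρ x y • (Φ (Matrix.single x.1 y.1 1) ⊗ₖ Ψ (Matrix.single x.2 y.2 1))
  map_add' ρ σ := by
    simp [add_smul, Finset.sum_add_distrib]
  map_smul' r ρ := by
    simp [mul_smul, Finset.smul_sum]

theorem linearMap_apply_eq_sum_single {a c : Type*} [Fintype a] [DecidableEq a]
    (Φ : Matrix a a ℂ →ₗ[ℂ] Matrix c c ℂ) (A : Matrix a a ℂ) (i j : c) :
    Φ A i j = ∑ x, ∑ y, A x y * Φ (Matrix.single x y 1) i j := by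
  conv_lhs => rw [Matrix.matrix_eq_sum_single A]
  simp only [map_sum, Matrix.sum_apply]
  refine Finset.sum_congr rfl fun x _ => Finset.sum_congr rfl fun y _ => ?_
  have h : Matrix.single x y (A x y) = A x y • Matrix.single x y (1 : ℂ) := by simp
  rw [h, map_smul, Matrix.smul_apply, smul_eq_mul]

theorem tensorMap_kronecker {a b c d : Type*} [Fintype a] [DecidableEq a] [Fintype b]
    [DecidableEq b] (Φ : Matrix a a ℂ →ₗ[ℂ] Matrix c c ℂ) (Ψ : Matrix b b ℂ →ₗ[ℂ] Matrix d d ℂ)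
    (A : Matrix a a ℂ) (B : Matrix b b ℂ) :
    tensorMap Φ Ψ (A ⊗ₖ B) = Φ A ⊗ₖ Ψ B := by
  ext ⟨i, i'⟩ ⟨j, j'⟩
  simp only [tensorMap, LinearMap.coe_mk, AddHom.coe_mk, Matrix.sum_apply, Matrix.smul_apply,
    Matrix.kronecker_apply, smul_eq_mul, Fintype.sum_prod_type]
  rw [linearMap_apply_eq_sum_single Φ A i j, linearMap_apply_eq_sum_single Ψ B i' j', Finset.sum_mul_sum]
  refine Finset.sum_congr rfl fun x _ => Finset.sum_congr rfl fun x' _ => ?_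
  rw [Finset.sum_mul_sum]
  exact Finset.sum_congr rfl fun y _ => Finset.sum_congr rfl fun y' _ => by ring

/-- The Bell state `(1 / √n) ∑ i, |i⟩ ⊗ |i⟩`. -/
noncomputable def bellState (n : ℕ) : Fin n × Fin n → ℂ :=
  fun x => if x.1 = x.2 then ((√(n : ℝ) : ℝ) : ℂ)⁻¹ else 0

/-- The rank-one operator `|v⟩⟨v|`. -/
def ketbra {m : Type*} (v : m → ℂ) : Matrix m m ℂ := Matrix.vecMulVec v (star v)

/-- The Schatten `p`-norm: the `ℓ^p` norm (the maximum, for `p = ∞`) of the singular values. -/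
noncomputable def schattenNorm {m : Type*} [Fintype m] [DecidableEq m] (p : ℝ≥0∞)
    (A : Matrix m m ℂ) : ℝ :=
  ‖WithLp.toLp p fun i => √((Matrix.isHermitian_conjTranspose_mul_self A).eigenvalues i)‖

/-- The quantum states. -/
def quantumStates (m : Type*) [Fintype m] : Set (Matrix m m ℂ) :=
  {ρ | ρ.PosSemidef ∧ ρ.trace = 1}

/-- The maximum output `p`-norm: the maximum of `‖Φ ρ‖_p` over the quantum states `ρ`, as an
element of `[0, ∞]`. -/
noncomputable def maxOutputNorm {m l : Type*} [Fintype m] [Fintype l] [DecidableEq l] (p : ℝ≥0∞)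
    (Φ : Matrix m m ℂ →ₗ[ℂ] Matrix l l ℂ) : ℝ≥0∞ :=
  ⨆ ρ ∈ quantumStates m, ENNReal.ofReal (schattenNorm p (Φ ρ))

/-! On the Bell state, `(A ⊗ B̄) b_n` is the vectorisation of `A Bᴴ / √n`, so each entry of the
complementary output is `k⁻²` times a normalized trace `n⁻¹ Tr (X_a X_bᴴ X_c X_dᴴ)`. Such a trace
tends almost surely to the sum over the two noncrossing pairings of its four letters
(`semicircularMoment_four`). One pairing yields the identity, the other the Bell projection.

The convergence rests on Gaussian integration by parts. Differentiating a product of traces either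
splits a trace in two, at leading order, or merges two traces, at cost `n⁻²`
(`IsSchwingerDyson.recursion`). Dropping the merges leaves the recursion of the semicircular
moments, so by induction all moments agree up to `O(n⁻²)` (`momentApprox`). Applied to a word and
its reversal, this bounds the mean square deviation by `O(n⁻²)`. That is summable, whence almost
sure convergence whatever the joint law across dimensions. A Ginibre matrix is expanded into its two
GUEs.

For the norms, a pure input gives outputs `V Vᴴ` and `(Vᴴ V)ᵀ` with the same nonzero spectrum, and
convexity of the Schatten norm reduces all states to pure ones (`maxOutputNorm_cpMap_eq_complMap`).
For the lower bound the Bell state is inserted as input. The diagonal of the output in a fixed basis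
containing `b_k` depends continuously on the output, and its `ℓ^p` norm is at most the Schatten norm
(`norm_diag_le_schattenNorm`). -/

/-! ### Words, semicircular moments and the loop equation -/

section SchwingerDyson

variable {ι : Type*} [DecidableEq ι]

/-- The ways of writing a word as `u ++ a :: v`, recorded as the pairs `(u, v)`. -/
def splits (a : ι) : List ι → List (List ι × List ι)
  | [] => []
  | b :: w => (if a = b then [([], w)] else []) ++ (splits a w).map fun u => (b :: u.1, u.2)

theorem length_of_mem_splits (a : ι) (w : List ι) :
    ∀ u ∈ splits a w, u.1.length + u.2.length + 1 = w.length := by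
  induction w with
  | nil => simp [splits]
  | cons b w ih =>
    intro u hu
    rw [splits, List.mem_append, List.mem_map] at hu
    rcases hu with hu | ⟨v, hv, rfl⟩
    · split_ifs at hu
      · rw [List.mem_singleton] at hu
        subst hu
        simp
      · simp at hu
    · have := ih v hv
      simp only [List.length_cons]
      omega

/-- The mixed moments of a free semicircular family. -/
def semicircularMoment : List ι → ℂ
  | [] => 1
  | a :: w => ((splits a w).attach.map fun u =>
      semicircularMoment u.1.1 * semicircularMoment u.1.2).sum
termination_by w => w.length
decreasing_by
  all_goals
    have := length_of_mem_splits a w u.1 u.2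
    simp only [List.length_cons]
    omega

theorem semicircularMoment_nil : semicircularMoment ([] : List ι) = 1 := by
  rw [semicircularMoment]

theorem semicircularMoment_cons (a : ι) (w : List ι) :
    semicircularMoment (a :: w) =
      ((splits a w).map fun u => semicircularMoment u.1 * semicircularMoment u.2).sum := by
  rw [semicircularMoment]
  congr 1
  exact List.attach_map_val (f := fun u : List ι × List ι =>
    semicircularMoment u.1 * semicircularMoment u.2)

/-- Of the three pairings of four letters the crossing one, `a = c` and `b = d`, is absent. -/
theorem semicircularMoment_four (a b c d : ι) :
    semicircularMoment [a, b, c, d] =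
      (if a = b then 1 else 0) * (if c = d then 1 else 0) +
        (if a = d then 1 else 0) * (if b = c then 1 else 0) := by
  have h1 : ∀ x : ι, semicircularMoment [x] = 0 := fun x => by
    simp [semicircularMoment_cons, splits]
  have h2 : ∀ x y : ι, semicircularMoment [x, y] = if x = y then 1 else 0 := fun x y => by
    rw [semicircularMoment_cons]
    split_ifs with h <;> simp [splits, h, semicircularMoment_nil]
  rw [semicircularMoment_cons]
  by_cases hab : a = b <;> by_cases hac : a = c <;> by_cases had : a = d <;>
    simp [splits, hab, hac, had, h1, h2, semicircularMoment_nil] <;>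
    simp_all [semicircularMoment_nil]

/-- All lists of words obtained from `L` by replacing one word `u ++ a :: v` by `w ++ v ++ u`. -/
def merges (a : ι) (w : List ι) : List (List ι) → List (List (List ι))
  | [] => []
  | u :: L => ((splits a u).map fun s => (w ++ s.2 ++ s.1) :: L) ++ (merges a w L).map (u :: ·)

/-- The total length of a list of words, with every word counted as one letter longer. -/
def wordsSize (L : List (List ι)) : ℕ := (L.map fun w => w.length + 1).sum

/-- Makes `wordsSize` a termination measure: merging `a :: w` into `L` loses two letters and one
word. The extra letter counted per word lets the measure also drop when an empty word is removed. -/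
theorem wordsSize_of_mem_merges (a : ι) (w : List ι) (L : List (List ι)) :
    ∀ M ∈ merges a w L, wordsSize M + 1 = wordsSize L + w.length := by
  induction L with
  | nil => simp [merges]
  | cons u L ih =>
    intro M hM
    rw [merges, List.mem_append, List.mem_map, List.mem_map] at hM
    rcases hM with ⟨s, hs, rfl⟩ | ⟨N, hN, rfl⟩
    · have := length_of_mem_splits a u s hs
      simp only [wordsSize, List.map_cons, List.sum_cons, List.length_append]
      omega
    · have := ih N hN
      simp only [wordsSize, List.map_cons, List.sum_cons] at this ⊢
      omega

/-- A linear functional `E` on a commutative algebra for which the matrices `x a` satisfy the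
integration by parts formula of independent Gaussian unitary ensembles. -/
structure IsSchwingerDyson {A : Type*} [CommRing A] [Algebra ℂ A] {n : ℕ}
    (x : ι → Matrix (Fin n) (Fin n) A) (D : ι → Fin n → Fin n → Derivation ℂ A A)
    (E : A →ₗ[ℂ] ℂ) : Prop where
  map_one : E 1 = 1
  deriv : ∀ a i j b p q, D a i j (x b p q) = if a = b ∧ p = j ∧ q = i then 1 else 0
  parts : ∀ a i j f, E (x a i j * f) = (n : ℂ)⁻¹ * E (D a i j f)

variable {A : Type*} [CommRing A] [Algebra ℂ A] {n : ℕ}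

/-- The product of the matrices `x a` along a word. -/
def wordProd (x : ι → Matrix (Fin n) (Fin n) A) (w : List ι) : Matrix (Fin n) (Fin n) A :=
  (w.map x).prod

/-- The normalized trace of the product of the matrices `x a` along a word. -/
noncomputable def wordTrace (x : ι → Matrix (Fin n) (Fin n) A) (w : List ι) : A :=
  (n : ℂ)⁻¹ • (wordProd x w).trace

variable {x : ι → Matrix (Fin n) (Fin n) A} {D : ι → Fin n → Fin n → Derivation ℂ A A}
  {E : A →ₗ[ℂ] ℂ}

omit [DecidableEq ι] [Algebra ℂ A] in
theorem wordProd_cons (a : ι) (w : List ι) : wordProd x (a :: w) = x a * wordProd x w := by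
  simp [wordProd]

omit [DecidableEq ι] [Algebra ℂ A] in
theorem wordProd_append (w v : List ι) : wordProd x (w ++ v) = wordProd x w * wordProd x v := by
  simp [wordProd]

/-- By the Leibniz rule each occurrence of `a` cuts the word; the Kronecker deltas of `deriv` end
the left piece at `j` and start the right piece at `i`. -/
theorem IsSchwingerDyson.deriv_wordProd (h : IsSchwingerDyson x D E) (a : ι) (i j : Fin n)
    (w : List ι) (p q : Fin n) :
    D a i j (wordProd x w p q) =
      ((splits a w).map fun u => wordProd x u.1 p j * wordProd x u.2 i q).sum := by
  induction w generalizing p q with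
  | nil =>
    simp only [wordProd, splits, List.map_nil, List.prod_nil, List.sum_nil, Matrix.one_apply]
    split_ifs <;> simp
  | cons b w ih =>
    rw [wordProd_cons, Matrix.mul_apply, map_sum]
    simp only [Derivation.leibniz, smul_eq_mul, ih, h.deriv, Finset.sum_add_distrib]
    rw [splits, List.map_append, List.sum_append, List.map_map, add_comm]
    congr 1
    · by_cases hab : a = b
      · subst hab
        by_cases hp : p = j <;>
          simp [hp, wordProd]
      · simp [hab]
    · simp only [Function.comp_def, wordProd_cons, Matrix.mul_apply, Finset.sum_mul,
        ← List.sum_map_mul_left]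
      generalize splits a w = l
      induction l with
      | nil => simp
      | cons u l ih' =>
        simp only [List.map_cons, List.sum_cons, Finset.sum_add_distrib, ih', mul_assoc]

/-- The derivation `∑ i j, W j i • D a i j` for the matrix `W` of a word. -/
noncomputable def mergeDeriv (x : ι → Matrix (Fin n) (Fin n) A)
    (D : ι → Fin n → Fin n → Derivation ℂ A A) (a : ι) (w : List ι) : Derivation ℂ A A :=
  ∑ i, ∑ j, wordProd x w j i • D a i j

omit [DecidableEq ι] in
theorem mergeDeriv_apply (a : ι) (w : List ι) (f : A) :
    mergeDeriv x D a w f = ∑ i, ∑ j, wordProd x w j i * D a i j f := by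
  simp only [mergeDeriv, ← Derivation.coeFnAddMonoidHom_apply, map_sum, Finset.sum_apply]
  simp

/-- Contracting with the matrix of `w` inserts it at the cut, and cyclicity of the trace gives the
stated order. The one factor `n⁻¹` is exactly the normalization of the merged trace. -/
theorem IsSchwingerDyson.mergeDeriv_wordTrace (h : IsSchwingerDyson x D E) (a : ι) (w u : List ι) :
    mergeDeriv x D a w (wordTrace x u) =
      ((splits a u).map fun s => wordTrace x (w ++ s.2 ++ s.1)).sum := by
  have h1 : ∀ i j, D a i j (wordTrace x u) = (n : ℂ)⁻¹ • ∑ p,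
      ((splits a u).map fun s => wordProd x s.1 p j * wordProd x s.2 i p).sum := fun i j => by
    rw [wordTrace, Matrix.trace, Derivation.map_smul, map_sum]
    simp only [Matrix.diag_apply, h.deriv_wordProd]
  simp only [mergeDeriv_apply, h1]
  generalize splits a u = l
  induction l with
  | nil => simp
  | cons s l ih =>
    rw [List.map_cons, List.sum_cons, ← ih]
    simp only [List.map_cons, List.sum_cons, Finset.sum_add_distrib, smul_add, mul_add]
    congr 1
    simp only [wordTrace, Matrix.trace, Matrix.diag_apply, wordProd_append, Matrix.mul_apply,
      Finset.mul_sum, Finset.sum_mul, Finset.smul_sum, mul_smul_comm]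
    rw [Finset.sum_comm]
    refine Finset.sum_congr rfl fun j _ => ?_
    rw [Finset.sum_comm]
    refine Finset.sum_congr rfl fun p _ => Finset.sum_congr rfl fun i _ => ?_
    congr 1
    ring

theorem IsSchwingerDyson.mergeDeriv_prod (h : IsSchwingerDyson x D E) (a : ι) (w : List ι)
    (L : List (List ι)) :
    mergeDeriv x D a w (L.map (wordTrace x)).prod =
      ((merges a w L).map fun M => (M.map (wordTrace x)).prod).sum := by
  induction L with
  | nil => simp [merges]
  | cons u L ih =>
    rw [List.map_cons, List.prod_cons, Derivation.leibniz, ih, h.mergeDeriv_wordTrace, merges,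
      List.map_append, List.sum_append, List.map_map, List.map_map, add_comm, smul_eq_mul,
      smul_eq_mul, ← List.sum_map_mul_left, ← List.sum_map_mul_left]
    simp only [Function.comp_def, List.map_cons, List.prod_cons]
    congr 3
    funext s
    ring

/-- Integration by parts in the leading letter. A derivative hitting the same trace produces two
traces, whose normalizations absorb the whole `n⁻²`; one hitting another trace merges the two, and
the `n⁻²` survives. -/
theorem IsSchwingerDyson.recursion (h : IsSchwingerDyson x D E) (a : ι) (w : List ι)
    (L : List (List ι)) :
    E (((a :: w) :: L).map (wordTrace x)).prod =
      ((splits a w).map fun u => E ((u.1 :: u.2 :: L).map (wordTrace x)).prod).sum +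
      ((n : ℂ) ^ 2)⁻¹ *
        ((merges a w L).map fun M => E (M.map (wordTrace x)).prod).sum := by
  set F := (L.map (wordTrace x)).prod with hF
  have h1 : (((a :: w) :: L).map (wordTrace x)).prod =
      (n : ℂ)⁻¹ • ∑ i, ∑ j, x a i j * (wordProd x w j i * F) := by
    rw [List.map_cons, List.prod_cons, wordTrace, wordProd_cons, Matrix.trace, smul_mul_assoc,
      Finset.sum_mul]
    congr 1
    refine Finset.sum_congr rfl fun i _ => ?_
    rw [Matrix.diag, Matrix.mul_apply, Finset.sum_mul]
    exact Finset.sum_congr rfl fun j _ => mul_assoc _ _ _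
  have h2 : (∑ i, ∑ j, D a i j (wordProd x w j i * F)) =
      (∑ i, ∑ j, D a i j (wordProd x w j i)) * F + mergeDeriv x D a w F := by
    simp only [mergeDeriv_apply, Derivation.leibniz, Finset.sum_mul, ← Finset.sum_add_distrib,
      smul_eq_mul]
    refine Finset.sum_congr rfl fun i _ => Finset.sum_congr rfl fun j _ => ?_
    ring
  have h3 : ((n : ℂ) ^ 2)⁻¹ • ((∑ i, ∑ j, D a i j (wordProd x w j i)) * F) =
      ((splits a w).map fun u => ((u.1 :: u.2 :: L).map (wordTrace x)).prod).sum := by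
    simp only [h.deriv_wordProd]
    generalize splits a w = l
    induction l with
    | nil => simp
    | cons u l ih =>
      rw [List.map_cons, List.sum_cons, ← ih]
      simp only [List.map_cons, List.sum_cons, List.prod_cons, Finset.sum_add_distrib, add_mul,
        smul_add]
      congr 1
      simp only [wordTrace, Matrix.trace, Matrix.diag, ← Finset.sum_mul, ← Finset.mul_sum,
        smul_mul_assoc, mul_smul_comm, smul_smul]
      rw [← hF, ← mul_inv, ← sq]
      congr 1
      ring
  have h4 : E (((a :: w) :: L).map (wordTrace x)).prod =
      E (((n : ℂ) ^ 2)⁻¹ • ∑ i, ∑ j, D a i j (wordProd x w j i * F)) := by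
    rw [h1]
    simp only [map_smul, map_sum, h.parts, ← Finset.mul_sum, smul_eq_mul]
    ring
  rw [h4, h2, smul_add, h3, h.mergeDeriv_prod, map_add, map_smul,
    map_list_sum, map_list_sum, List.map_map, List.map_map, smul_eq_mul]
  rfl

end SchwingerDyson

/-! ### Moments up to order `n⁻²` -/

section MomentBound

universe u v

/-- The expectation of the product of the traces of the words in `L` differs from the product of
the semicircular moments by `O(1 / n ^ 2)`, uniformly over all Schwinger–Dyson systems. -/
def MomentApprox {ι : Type u} [DecidableEq ι] (L : List (List ι)) : Prop :=
  ∃ C : ℝ, ∀ (n : ℕ) (A : Type v) [CommRing A] [Algebra ℂ A]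
    (x : ι → Matrix (Fin n) (Fin n) A) (D : ι → Fin n → Fin n → Derivation ℂ A A)
    (E : A →ₗ[ℂ] ℂ), 0 < n → IsSchwingerDyson x D E →
    ‖E (L.map (wordTrace x)).prod - (L.map semicircularMoment).prod‖ ≤ C / (n : ℝ) ^ 2

variable {ι : Type u} [DecidableEq ι]

theorem exists_bound_sum_of_momentApprox {Q : List (List (List ι))}
    (hQ : ∀ M ∈ Q, MomentApprox.{u, v} M) :
    ∃ C : ℝ, ∀ (n : ℕ) (A : Type v) [CommRing A] [Algebra ℂ A]
      (x : ι → Matrix (Fin n) (Fin n) A) (D : ι → Fin n → Fin n → Derivation ℂ A A)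
      (E : A →ₗ[ℂ] ℂ), 0 < n → IsSchwingerDyson x D E →
      ‖(Q.map fun M => E (M.map (wordTrace x)).prod).sum -
        (Q.map fun M => (M.map semicircularMoment).prod).sum‖ ≤ C / (n : ℝ) ^ 2 := by
  induction Q with
  | nil => exact ⟨0, fun n A _ _ x D E _ _ => by simp⟩
  | cons M Q ih =>
    obtain ⟨C₁, h₁⟩ := hQ M (by simp)
    obtain ⟨C₂, h₂⟩ := ih fun N hN => hQ N (by simp [hN])
    refine ⟨C₁ + C₂, fun n A _ _ x D E hn h => ?_⟩
    rw [List.map_cons, List.map_cons, List.sum_cons, List.sum_cons, add_sub_add_comm, add_div]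
    exact (norm_add_le _ _).trans (add_le_add (h₁ n A x D E hn h) (h₂ n A x D E hn h))

/-- Strong induction on `wordsSize`: `semicircularMoment_cons` is the loop equation without its
merge term, so the errors are those of strictly smaller lists plus `n⁻²` times a bounded quantity.
-/
theorem momentApprox (L : List (List ι)) : MomentApprox.{u, v} L := by
  induction hN : wordsSize L using Nat.strong_induction_on generalizing L with
  | _ N ih =>
  subst hN
  rcases L with _ | ⟨_ | ⟨a, w⟩, L⟩
  · exact ⟨0, fun n A _ _ x D E _ h => by simp [h.map_one]⟩
  · obtain ⟨C, hC⟩ := ih (wordsSize L) (by simp [wordsSize]) L rfl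
    refine ⟨C, fun n A _ _ x D E hn h => ?_⟩
    have h1 : wordTrace x [] = 1 := by
      have hn' : (n : ℂ) ≠ 0 := by exact_mod_cast hn.ne'
      rw [wordTrace, wordProd, List.map_nil, List.prod_nil, Matrix.trace_one, Fintype.card_fin,
        Algebra.smul_def, ← map_natCast (algebraMap ℂ A) n, ← map_mul, inv_mul_cancel₀ hn', map_one]
    simpa [h1, semicircularMoment_nil] using hC n A x D E hn h
  · obtain ⟨C₁, h₁⟩ := exists_bound_sum_of_momentApprox.{u, v}
      (Q := (splits a w).map fun u => u.1 :: u.2 :: L) (fun M hM => by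
        obtain ⟨u, hu, rfl⟩ := List.mem_map.1 hM
        refine ih _ ?_ _ rfl
        have := length_of_mem_splits a w u hu
        simp only [wordsSize, List.map_cons, List.sum_cons, List.length_cons]
        omega)
    obtain ⟨C₂, h₂⟩ := exists_bound_sum_of_momentApprox.{u, v}
      (Q := merges a w L) (fun M hM => by
        refine ih _ ?_ _ rfl
        have := wordsSize_of_mem_merges a w L M hM
        simp only [wordsSize, List.map_cons, List.sum_cons, List.length_cons] at this ⊢
        omega)
    set S := ((merges a w L).map fun M => (M.map semicircularMoment).prod).sum
    -- `C₁` accounts for the splits. The merge term already carries `n⁻²`, so it only has to be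
    -- bounded, by its limit `S` plus the error `C₂ / n ^ 2 ≤ C₂`.
    refine ⟨C₁ + (C₂ + ‖S‖), fun n A _ _ x D E hn h => ?_⟩
    have hn1 : (1 : ℝ) ≤ n := by exact_mod_cast hn
    have e1 := h₁ n A x D E hn h
    have e2 := h₂ n A x D E hn h
    rw [h.recursion, List.map_cons, List.prod_cons, semicircularMoment_cons,
      ← List.sum_map_mul_right]
    simp only [List.map_map, Function.comp_def] at e1
    simp only [List.map_cons, List.prod_cons, mul_assoc] at e1 ⊢
    rw [add_sub_right_comm, add_div]
    refine (norm_add_le _ _).trans (add_le_add e1 ?_)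
    rw [norm_mul, norm_inv, norm_pow, Complex.norm_natCast, div_eq_inv_mul]
    refine mul_le_mul_of_nonneg_left ?_ (by positivity)
    refine (norm_le_norm_sub_add _ S).trans (add_le_add_left (e2.trans ?_) _)
    have hC : 0 ≤ C₂ := by
      have := (norm_nonneg _).trans e2
      by_contra hlt
      exact absurd this (not_le.2 (div_neg_of_neg_of_pos (not_le.1 hlt) (by positivity)))
    exact div_le_self hC (one_le_pow₀ hn1)

end MomentBound

/-! ### Gaussian integration by parts for polynomials -/

section GaussianMoments

theorem integrable_pow_gaussianReal (v : ℝ≥0) (m : ℕ) :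
    Integrable (fun x : ℝ => x ^ m) (gaussianReal 0 v) := by
  have h : MemLp id m (gaussianReal 0 v) := memLp_id_gaussianReal' m (ENNReal.natCast_ne_top m)
  refine (integrable_norm_iff (by fun_prop)).1 ?_
  simpa using h.integrable_norm_pow'

theorem hasDerivAt_gaussianPDFReal {v : ℝ≥0} (hv : v ≠ 0) (x : ℝ) :
    HasDerivAt (gaussianPDFReal 0 v) (-(x / v) * gaussianPDFReal 0 v x) x := by
  have hv' : (v : ℝ) ≠ 0 := by exact_mod_cast hv
  rw [gaussianPDFReal_def]
  have h : HasDerivAt (fun x : ℝ => -(x - 0) ^ 2 / (2 * v)) (-(x / v)) x := by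
    convert! (((hasDerivAt_id x).sub_const 0).pow 2).neg.div_const (2 * (v : ℝ)) using 1
    simp only [id]
    field_simp
    simp [mul_comm]
  convert! h.exp.const_mul ((√(2 * Real.pi * v))⁻¹) using 1
  ring

theorem integrable_gaussianPDFReal_mul_pow {v : ℝ≥0} (hv : v ≠ 0) (m : ℕ) :
    Integrable fun x : ℝ => gaussianPDFReal 0 v x * x ^ m := by
  have h := integrable_pow_gaussianReal v m
  rw [gaussianReal_of_var_ne_zero _ hv,
    integrable_withDensity_iff_integrable_smul' (measurable_gaussianPDF _ _)
      (ae_of_all _ fun _ => gaussianPDF_lt_top)] at h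
  simpa using h

/-- Gaussian integration by parts for monomials. -/
theorem integral_mul_pow_gaussianReal {v : ℝ≥0} (hv : v ≠ 0) (m : ℕ) :
    ∫ x, x * x ^ m ∂(gaussianReal 0 v) = v * (m * ∫ x, x ^ (m - 1) ∂(gaussianReal 0 v)) := by
  have hv' : (v : ℝ) ≠ 0 := by exact_mod_cast hv
  have h := integral_mul_deriv_eq_deriv_mul_of_integrable (u := fun x : ℝ => x ^ m)
    (u' := fun x => m * x ^ (m - 1)) (v := gaussianPDFReal 0 v)
    (v' := fun x => -(x / v) * gaussianPDFReal 0 v x)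
    (fun x _ => hasDerivAt_pow m x) (fun x _ => hasDerivAt_gaussianPDFReal hv x)
    (by
      convert! (integrable_gaussianPDFReal_mul_pow hv (m + 1)).const_mul (-(v : ℝ)⁻¹) using 1
      funext x
      simp only [Pi.mul_apply]
      ring)
    (by
      convert! (integrable_gaussianPDFReal_mul_pow hv (m - 1)).const_mul (m : ℝ) using 1
      funext x
      simp only [Pi.mul_apply]
      ring)
    (by
      convert! integrable_gaussianPDFReal_mul_pow hv m using 1
      funext x
      simp only [Pi.mul_apply]
      ring)
  rw [integral_gaussianReal_eq_integral_smul hv, integral_gaussianReal_eq_integral_smul hv]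
  have e1 : ∀ x : ℝ, x ^ m * (-(x / v) * gaussianPDFReal 0 v x) =
      -(v : ℝ)⁻¹ * (gaussianPDFReal 0 v x • (x * x ^ m)) := fun x => by
    rw [smul_eq_mul]; ring
  have e2 : ∀ x : ℝ, (m : ℝ) * x ^ (m - 1) * gaussianPDFReal 0 v x =
      m * (gaussianPDFReal 0 v x • x ^ (m - 1)) := fun x => by
    rw [smul_eq_mul]; ring
  simp only [e1, e2, integral_const_mul] at h
  have h' := congrArg (fun y => -(v : ℝ) * y) h
  rw [← mul_assoc, neg_mul_neg, mul_inv_cancel₀ hv', one_mul] at h'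
  rw [h', neg_mul_neg]

variable {Ω : Type*} [MeasurableSpace Ω] {P : Measure Ω} {σ : Type*}

/-- The exponent varies in the induction because, by Hölder, multiplying by a variable requires both
factors in `L^(2q)`. Independence plays no role. -/
theorem memLp_aeval_gaussian [IsFiniteMeasure P] {g : σ → Ω → ℝ} {v : ℝ≥0}
    (hg : ∀ e, HasLaw (g e) (gaussianReal 0 v) P) (f : MvPolynomial σ ℂ) (q : ℝ≥0) :
    MemLp (fun ω => MvPolynomial.aeval (fun e => (g e ω : ℂ)) f) q P := by
  induction f using MvPolynomial.induction_on generalizing q with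
  | C c => simpa using memLp_const c
  | add f₁ f₂ h₁ h₂ => simpa using! (h₁ q).add (h₂ q)
  | mul_X f e h =>
    have h1 : MemLp (fun ω => (g e ω : ℂ)) ((2 * q : ℝ≥0) : ℝ≥0∞) P := by
      have h0 : MemLp id ((2 * q : ℝ≥0) : ℝ≥0∞) (P.map (g e)) := by
        rw [(hg e).map_eq]
        exact memLp_id_gaussianReal _
      exact (h0.comp_of_map (hg e).aemeasurable).ofReal
    have : ENNReal.HolderTriple ((2 * q : ℝ≥0) : ℝ≥0∞) ((2 * q : ℝ≥0) : ℝ≥0∞) q := by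
      constructor
      rw [ENNReal.coe_mul, ENNReal.mul_inv (by simp) (by simp), ← two_mul, ← mul_assoc,
        ENNReal.coe_ofNat, ENNReal.mul_inv_cancel (by simp) (by simp), one_mul]
    simpa using MemLp.mul' h1 (h (2 * q))

theorem integrable_aeval_gaussian [IsFiniteMeasure P] {g : σ → Ω → ℝ} {v : ℝ≥0}
    (hg : ∀ e, HasLaw (g e) (gaussianReal 0 v) P) (f : MvPolynomial σ ℂ) :
    Integrable (fun ω => MvPolynomial.aeval (fun e => (g e ω : ℂ)) f) P :=
  memLp_one_iff_integrable.1 (by simpa using memLp_aeval_gaussian hg f 1)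

/-- The expectation of polynomials in a family of Gaussian variables. -/
noncomputable def gaussianExpectation [IsFiniteMeasure P] {g : σ → Ω → ℝ} {v : ℝ≥0}
    (hg : ∀ e, HasLaw (g e) (gaussianReal 0 v) P) : MvPolynomial σ ℂ →ₗ[ℂ] ℂ where
  toFun f := ∫ ω, MvPolynomial.aeval (fun e => (g e ω : ℂ)) f ∂P
  map_add' f₁ f₂ := by
    simp only [map_add]
    exact integral_add (integrable_aeval_gaussian hg f₁) (integrable_aeval_gaussian hg f₂)
  map_smul' c f := by
    simp only [map_smul, smul_eq_mul, RingHom.id_apply]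
    exact integral_const_mul _ _

theorem gaussianExpectation_monomial [Fintype σ] [IsFiniteMeasure P] {g : σ → Ω → ℝ} {v : ℝ≥0}
    (hg : ∀ e, HasLaw (g e) (gaussianReal 0 v) P) (hi : iIndepFun g P) (s : σ →₀ ℕ) (c : ℂ) :
    gaussianExpectation hg (MvPolynomial.monomial s c) =
      c * ∏ e, ((∫ x, x ^ s e ∂(gaussianReal 0 v) : ℝ) : ℂ) := by
  have h1 : ∀ ω, MvPolynomial.aeval (fun e => (g e ω : ℂ)) (MvPolynomial.monomial s c) =
      c * ((∏ e, g e ω ^ s e : ℝ) : ℂ) := fun ω => by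
    rw [MvPolynomial.aeval_monomial, Finsupp.prod_fintype _ _ (by simp)]
    simp
  have h2 := hi.integral_fun_prod_comp (f := fun e x => x ^ s e) (𝕜 := ℝ)
    (fun e => (hg e).aemeasurable) (fun e => by fun_prop)
  simp only [gaussianExpectation, LinearMap.coe_mk, AddHom.coe_mk, h1]
  rw [integral_const_mul, integral_complex_ofReal, h2, Complex.ofReal_prod]
  congr 1
  refine Finset.prod_congr rfl fun e _ => ?_
  rw [← (hg e).integral_comp (by fun_prop)]
  rfl

/-- Gaussian integration by parts for polynomials in independent Gaussian variables. -/
theorem gaussianExpectation_X_mul [Fintype σ] [IsFiniteMeasure P] {g : σ → Ω → ℝ} {v : ℝ≥0}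
    (hv : v ≠ 0) (hg : ∀ e, HasLaw (g e) (gaussianReal 0 v) P) (hi : iIndepFun g P) (e : σ)
    (f : MvPolynomial σ ℂ) :
    gaussianExpectation hg (MvPolynomial.X e * f) =
      ((v : ℝ) : ℂ) * gaussianExpectation hg (MvPolynomial.pderiv e f) := by
  classical
  induction f using MvPolynomial.induction_on' with
  | add f₁ f₂ h₁ h₂ => rw [mul_add, map_add, h₁, h₂, map_add, map_add, mul_add]
  | monomial s c =>
    rw [MvPolynomial.X, MvPolynomial.monomial_mul, one_mul, MvPolynomial.pderiv_monomial,
      gaussianExpectation_monomial hg hi, gaussianExpectation_monomial hg hi,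
      ← Finset.mul_prod_erase _ _ (Finset.mem_univ e),
      ← Finset.mul_prod_erase _ (fun e' => ((∫ x, x ^ (s - Finsupp.single e 1 : σ →₀ ℕ) e'
        ∂(gaussianReal 0 v) : ℝ) : ℂ)) (Finset.mem_univ e)]
    -- If `s e = 0`, the truncated exponent is harmless, since the factor `s e` vanishes.
    have h1 : ∫ x, x ^ (Finsupp.single e 1 + s : σ →₀ ℕ) e ∂(gaussianReal 0 v) =
        v * (s e * ∫ x, x ^ (s - Finsupp.single e 1 : σ →₀ ℕ) e ∂(gaussianReal 0 v)) := by
      simp only [Finsupp.add_apply, Finsupp.single_eq_same, Finsupp.tsub_apply]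
      rw [← integral_mul_pow_gaussianReal hv]
      simp only [pow_add, pow_one]
    rw [h1]
    have h2 : ∀ e' ∈ Finset.univ.erase e,
        ((∫ x, x ^ (Finsupp.single e 1 + s : σ →₀ ℕ) e' ∂(gaussianReal 0 v) : ℝ) : ℂ) =
        ((∫ x, x ^ (s - Finsupp.single e 1 : σ →₀ ℕ) e' ∂(gaussianReal 0 v) : ℝ) : ℂ) := fun e' he' => by
      have hne : e ≠ e' := (Finset.ne_of_mem_erase he').symm
      simp [Finsupp.single_eq_of_ne hne.symm]
    rw [Finset.prod_congr rfl h2]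
    push_cast
    ring

end GaussianMoments

/-! ### The GUE as a Schwinger–Dyson system -/

section UnitaryEnsemble

/-- The entry `(i, j)` of a Hermitian matrix in terms of its real coordinates `f`. -/
noncomputable def hermEntry {M : Type*} [AddCommGroup M] [Module ℂ M] {n : ℕ}
    (f : Fin n × Fin n → M) (i j : Fin n) : M :=
  if i = j then f (i, i)
  else if i < j then ((√2 : ℝ) : ℂ)⁻¹ • (f (i, j) + Complex.I • f (j, i))
  else ((√2 : ℝ) : ℂ)⁻¹ • (f (j, i) - Complex.I • f (i, j))

/-- Being formal over any complex module, `hermEntry` serves numbers, polynomial variables and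
derivations alike; this lemma moves between them. -/
theorem map_hermEntry {M N : Type*} [AddCommGroup M] [Module ℂ M] [AddCommGroup N] [Module ℂ N]
    {n : ℕ} (L : M →ₗ[ℂ] N) (f : Fin n × Fin n → M) (i j : Fin n) :
    L (hermEntry f i j) = hermEntry (fun e => L (f e)) i j := by
  unfold hermEntry
  split_ifs <;> simp

theorem ofReal_sqrt_two_inv_mul_self : ((√2 : ℝ) : ℂ)⁻¹ * ((√2 : ℝ) : ℂ)⁻¹ = 2⁻¹ := by
  rw [← mul_inv, ← Complex.ofReal_mul, Real.mul_self_sqrt (by norm_num)]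
  norm_num

theorem hermEntry_gueCoord {n : ℕ} {S : Matrix (Fin n) (Fin n) ℂ} (hS : S.IsHermitian)
    (i j : Fin n) : hermEntry (fun e => (gueCoord S e : ℂ)) i j = S i j := by
  have h2 : ((√2 : ℝ) : ℂ) ≠ 0 := by simp
  have key : ∀ a b, (((S a b).re : ℝ) : ℂ) + Complex.I * ((S a b).im : ℝ) = S a b := fun a b => by
    rw [mul_comm]; exact Complex.re_add_im _
  have hre : ∀ a b, (S a b).re = (S b a).re := fun a b => by
    rw [← hS.apply a b]; simp
  have him : ∀ a b, (S a b).im = -(S b a).im := fun a b => by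
    rw [← hS.apply a b]; simp
  rcases lt_trichotomy i j with h | rfl | h
  · simp only [hermEntry, gueCoord, h.ne, h.ne', h, h.not_gt, if_true, if_false]
    refine Eq.trans ?_ (key i j)
    rw [smul_eq_mul, smul_eq_mul]
    push_cast
    field_simp
  · have := him i i
    have h0 : (S i i).im = 0 := by linarith
    have h1 := key i i
    rw [h0] at h1
    simpa [hermEntry, gueCoord] using h1
  · simp only [hermEntry, gueCoord, h.ne, h.ne', h, h.not_gt, if_true, if_false]
    refine Eq.trans ?_ (key i j)
    rw [hre i j, him i j, smul_eq_mul, smul_eq_mul]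
    push_cast
    field_simp
    ring

/-- The GUE covariance: the contributions of real and imaginary parts cancel when `(i, j)` is paired
with itself off the diagonal, and add up when it is paired with `(j, i)`. -/
theorem hermEntry_hermEntry_ite {n : ℕ} (i j p q : Fin n) :
    hermEntry (fun e => hermEntry (fun e' => if e = e' then (1 : ℂ) else 0) p q) i j =
      if p = j ∧ q = i then 1 else 0 := by
  have h2 := ofReal_sqrt_two_inv_mul_self
  have hI := Complex.I_mul_I
  simp only [hermEntry, Prod.mk.injEq, smul_eq_mul]
  generalize ((√2 : ℝ) : ℂ)⁻¹ = r at h2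
  generalize Complex.I = I at hI
  have h2' : 2 * (r * r) = 1 := by rw [h2]; norm_num
  grind

/-- The generic Hermitian matrices, with independent real coordinates as polynomial variables. -/
noncomputable def genericHerm (ι : Type*) (n : ℕ) (a : ι) :
    Matrix (Fin n) (Fin n) (MvPolynomial (ι × (Fin n × Fin n)) ℂ) :=
  Matrix.of fun i j => hermEntry (fun e => MvPolynomial.X (a, e)) i j

theorem genericHerm_apply (ι : Type*) (n : ℕ) (a : ι) (i j : Fin n) :
    genericHerm ι n a i j = hermEntry (fun e => MvPolynomial.X (a, e)) i j := rfl

/-- The derivation dual to the entry `(j, i)` of the generic Hermitian matrix `a`. -/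
noncomputable def genericDeriv (ι : Type*) (n : ℕ) (a : ι) (i j : Fin n) :
    Derivation ℂ (MvPolynomial (ι × (Fin n × Fin n)) ℂ) (MvPolynomial (ι × (Fin n × Fin n)) ℂ) :=
  hermEntry (fun e => MvPolynomial.pderiv (a, e)) i j

variable {Ω ι : Type*} [MeasurableSpace Ω] {P : Measure Ω} {n : ℕ}
  {S : ι → Ω → Matrix (Fin n) (Fin n) ℂ}

/-- The expectation of polynomials in the real coordinates of a family of unitary ensembles. -/
noncomputable def IsGUEFamily.expectation [IsFiniteMeasure P] (hS : IsGUEFamily S P) :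
    MvPolynomial (ι × (Fin n × Fin n)) ℂ →ₗ[ℂ] ℂ :=
  gaussianExpectation (P := P) (g := fun (x : ι × (Fin n × Fin n)) ω => gueCoord (S x.1 ω) x.2)
    fun x => hS.hasLaw x.1 x.2

/-- Entries and derivations are the same linear combinations of coordinates, so scalar integration
by parts with variance `1 / n` passes to entries, and `deriv` reduces to the covariance identity. -/
theorem IsGUEFamily.isSchwingerDyson [Fintype ι] [DecidableEq ι] [IsProbabilityMeasure P]
    (hS : IsGUEFamily S P) (hn : 0 < n) :
    IsSchwingerDyson (genericHerm ι n) (genericDeriv ι n) hS.expectation where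
  map_one := by
    simp [IsGUEFamily.expectation, gaussianExpectation]
  deriv a i j b p q := by
    have h1 : ∀ f, genericDeriv ι n a i j f =
        hermEntry (fun e => MvPolynomial.pderiv (a, e) f) i j := fun f => by
      unfold genericDeriv hermEntry
      split_ifs <;> simp
    have h2 : ∀ e, MvPolynomial.pderiv (a, e) (genericHerm ι n b p q) =
        hermEntry (fun e' => MvPolynomial.pderiv (R := ℂ) (a, e) (MvPolynomial.X (b, e'))) p q :=
      fun e => by
        rw [genericHerm_apply, ← Derivation.coeFn_coe, map_hermEntry]
    by_cases hab : a = b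
    · subst hab
      have h3 : ∀ e e', MvPolynomial.pderiv (R := ℂ) (a, e) (MvPolynomial.X (a, e')) =
          Algebra.linearMap ℂ (MvPolynomial (ι × (Fin n × Fin n)) ℂ)
            (if e = e' then (1 : ℂ) else 0) := fun e e' => by
        rw [MvPolynomial.pderiv_X, Pi.single_apply]
        by_cases h : e = e'
        · simp [h]
        · simp [h, Ne.symm h]
      simp only [h1, h2, h3, ← map_hermEntry, hermEntry_hermEntry_ite, true_and]
      split_ifs <;> simp
    · have h3 : ∀ e e' : Fin n × Fin n,
          MvPolynomial.pderiv (R := ℂ) (a, e) (MvPolynomial.X (b, e')) = 0 :=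
        fun e e' => MvPolynomial.pderiv_X_of_ne (by simp [Ne.symm hab])
      simp [h1, h2, h3, hermEntry, hab]
  parts a i j f := by
    have hv : ((n : ℝ≥0)⁻¹) ≠ 0 := inv_ne_zero (by exact_mod_cast hn.ne')
    have h1 : hS.expectation (genericHerm ι n a i j * f) =
        hermEntry (fun e => hS.expectation (MvPolynomial.X (a, e) * f)) i j := by
      rw [genericHerm_apply]
      exact map_hermEntry (hS.expectation ∘ₗ LinearMap.mulRight ℂ f) _ i j
    have h2 : genericDeriv ι n a i j f =
        hermEntry (fun e => MvPolynomial.pderiv (a, e) f) i j := by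
      unfold genericDeriv hermEntry
      split_ifs <;> simp
    have h3 : ∀ e, hS.expectation (MvPolynomial.X (a, e) * f) =
        ((n : ℂ)⁻¹ • hS.expectation) (MvPolynomial.pderiv (a, e) f) := fun e => by
      rw [IsGUEFamily.expectation, gaussianExpectation_X_mul hv _ hS.indep]
      simp
    rw [h1, h2, ← smul_eq_mul, ← LinearMap.smul_apply, map_hermEntry]
    simp only [h3]

theorem map_wordTrace {A B : Type*} [CommRing A] [Algebra ℂ A] [CommRing B] [Algebra ℂ B]
    (f : A →ₐ[ℂ] B) (x : ι → Matrix (Fin n) (Fin n) A) (w : List ι) :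
    f (wordTrace x w) = wordTrace (fun a => (x a).map f) w := by
  have h : (wordProd x w).map f = wordProd (fun a => (x a).map f) w := by
    induction w with
    | nil => simp [wordProd]
    | cons a w ih => rw [wordProd_cons, wordProd_cons, Matrix.map_mul, ih]
  rw [wordTrace, wordTrace, map_smul, ← h, AddMonoidHom.map_trace f]

theorem conj_wordTrace {x : ι → Matrix (Fin n) (Fin n) ℂ} (hx : ∀ a, (x a).IsHermitian)
    (w : List ι) : conj (wordTrace x w) = wordTrace x w.reverse := by
  have h : (wordProd x w)ᴴ = wordProd x w.reverse := by
    induction w with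
    | nil => simp [wordProd]
    | cons a w ih =>
      rw [wordProd_cons, Matrix.conjTranspose_mul, ih, List.reverse_cons, wordProd_append,
        (hx a).eq]
      simp [wordProd]
  rw [wordTrace, wordTrace, ← h, Matrix.trace_conjTranspose]
  simp

theorem IsGUEFamily.ae_aeval_wordTrace [Countable ι] (hS : IsGUEFamily S P) :
    ∀ᵐ ω ∂P, ∀ w : List ι,
      MvPolynomial.aeval (fun x : ι × (Fin n × Fin n) => (gueCoord (S x.1 ω) x.2 : ℂ))
        (wordTrace (genericHerm ι n) w) = wordTrace (fun a => S a ω) w := by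
  filter_upwards [ae_all_iff.2 hS.isHermitian] with ω hω w
  rw [map_wordTrace]
  congr 1
  funext a
  ext i j
  rw [← hermEntry_gueCoord (hω a) i j, Matrix.map_apply, genericHerm_apply,
    ← AlgHom.toLinearMap_apply, map_hermEntry]
  simp only [AlgHom.toLinearMap_apply, MvPolynomial.aeval_X]

end UnitaryEnsemble

/-! ### Almost sure convergence of traces -/

section AlmostSureConvergence

universe u

/-- By Tonelli the series has finite expectation, hence converges almost surely. Nothing is needed
on the joint law of the terms. -/
theorem ae_tendsto_zero_of_summable_integral {Ω : Type*} [MeasurableSpace Ω] {P : Measure Ω}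
    {f : ℕ → Ω → ℝ} (hf : ∀ n ω, 0 ≤ f n ω) (hi : ∀ n, Integrable (f n) P)
    (hs : Summable fun n => ∫ ω, f n ω ∂P) : ∀ᵐ ω ∂P, Tendsto (fun n => f n ω) atTop (𝓝 0) := by
  have h1 : ∫⁻ ω, ∑' n, ENNReal.ofReal (f n ω) ∂P ≠ ∞ := by
    rw [lintegral_tsum fun n => (hi n).aemeasurable.ennreal_ofReal]
    simp only [← ofReal_integral_eq_lintegral_ofReal (hi _) (ae_of_all _ (hf _))]
    exact hs.tsum_ofReal_ne_top
  have h2 := ae_lt_top' (AEMeasurable.tsum fun n => (hi n).aemeasurable.ennreal_ofReal) h1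
  filter_upwards [h2] with ω hω
  have h3 := (ENNReal.summable_toReal hω.ne).tendsto_atTop_zero
  simpa only [ENNReal.toReal_ofReal (hf _ ω)] using h3

variable {ι : Type u} [Fintype ι] [DecidableEq ι]

/-- The conjugate of a trace of Hermitian matrices is the trace of the reversed word, so the squared
deviation is a polynomial in the coordinates and `momentApprox` applies to its expectation. -/
theorem exists_integral_norm_sq_wordTrace_sub_le (w : List ι)
    (hw : conj (semicircularMoment w) = semicircularMoment w.reverse) :
    ∃ C : ℝ, ∀ {Ω : Type*} [MeasurableSpace Ω] (P : Measure Ω) [IsProbabilityMeasure P] {n : ℕ}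
      (S : ι → Ω → Matrix (Fin n) (Fin n) ℂ), 0 < n → IsGUEFamily S P →
      Integrable (fun ω => ‖wordTrace (fun a => S a ω) w - semicircularMoment w‖ ^ 2) P ∧
      ∫ ω, ‖wordTrace (fun a => S a ω) w - semicircularMoment w‖ ^ 2 ∂P ≤ C / (n : ℝ) ^ 2 := by
  obtain ⟨C₁, h₁⟩ := momentApprox.{u, u} [w, w.reverse]
  obtain ⟨C₂, h₂⟩ := momentApprox.{u, u} [w]
  obtain ⟨C₃, h₃⟩ := momentApprox.{u, u} [w.reverse]
  set c := semicircularMoment w with hc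
  set c' := semicircularMoment w.reverse with hc'
  -- From `(T - c)(T' - c') = (T T' - c c') - c (T' - c') - c' (T - c)`.
  refine ⟨C₁ + ‖c‖ * C₃ + ‖c'‖ * C₂, fun {Ω} _ P _ {n} S hn hS => ?_⟩
  have hSD := hS.isSchwingerDyson hn
  set E := hS.expectation
  set T := wordTrace (genericHerm ι n) w
  set T' := wordTrace (genericHerm ι n) w.reverse
  have e₁ := h₁ n _ _ _ _ hn hSD
  have e₂ := h₂ n _ _ _ _ hn hSD
  have e₃ := h₃ n _ _ _ _ hn hSD
  simp only [List.map_cons, List.map_nil, List.prod_cons, List.prod_nil, mul_one, ← hc, ← hc']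
    at e₁ e₂ e₃
  set F := (T - MvPolynomial.C c) * (T' - MvPolynomial.C c') with hF
  have hae : (fun ω => ((‖wordTrace (fun a => S a ω) w - c‖ ^ 2 : ℝ) : ℂ)) =ᵐ[P] fun ω =>
      MvPolynomial.aeval (fun x : ι × (Fin n × Fin n) => (gueCoord (S x.1 ω) x.2 : ℂ)) F := by
    filter_upwards [hS.ae_aeval_wordTrace, ae_all_iff.2 hS.isHermitian] with ω h1 h2
    rw [hF, map_mul, map_sub, map_sub, h1, h1, ← conj_wordTrace h2, MvPolynomial.aeval_C,
      MvPolynomial.aeval_C, ← hw]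
    push_cast
    rw [← Complex.mul_conj', map_sub]
    rfl
  have hint : Integrable (fun ω => ((‖wordTrace (fun a => S a ω) w - c‖ ^ 2 : ℝ) : ℂ)) P :=
    (integrable_aeval_gaussian (fun x : ι × (Fin n × Fin n) => hS.hasLaw x.1 x.2) F).congr hae.symm
  have hint' : Integrable (fun ω => ‖wordTrace (fun a => S a ω) w - c‖ ^ 2) P :=
    hint.re.congr (ae_of_all _ fun ω => Complex.ofReal_re _)
  refine ⟨hint', ?_⟩
  have hval : ((∫ ω, ‖wordTrace (fun a => S a ω) w - c‖ ^ 2 ∂P : ℝ) : ℂ) = E F := by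
    rw [← integral_complex_ofReal, integral_congr_ae hae]
    rfl
  have hEC : ∀ z, E (MvPolynomial.C z) = z := fun z => by
    rw [MvPolynomial.C_eq_smul_one, map_smul, hSD.map_one, smul_eq_mul, mul_one]
  have hEF : E F = (E (T * T') - c * c') - c * (E T' - c') - c' * (E T - c) := by
    have : F = T * T' - c • T' - c' • T + MvPolynomial.C (c * c') := by
      rw [hF, MvPolynomial.smul_eq_C_mul, MvPolynomial.smul_eq_C_mul, map_mul]
      ring
    rw [this, map_add, map_sub, map_sub, map_smul, map_smul, hEC, smul_eq_mul, smul_eq_mul]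
    ring
  calc ∫ ω, ‖wordTrace (fun a => S a ω) w - c‖ ^ 2 ∂P
      ≤ ‖E F‖ := by
        rw [← hval, Complex.norm_real]
        exact le_abs_self _
    _ ≤ ‖E (T * T') - c * c'‖ + ‖c * (E T' - c')‖ + ‖c' * (E T - c)‖ := by
        rw [hEF]
        exact (norm_sub_le _ _).trans (add_le_add_left (norm_sub_le _ _) _)
    _ ≤ C₁ / (n : ℝ) ^ 2 + ‖c‖ * (C₃ / (n : ℝ) ^ 2) + ‖c'‖ * (C₂ / (n : ℝ) ^ 2) := by
        rw [norm_mul, norm_mul]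
        gcongr
    _ = _ := by ring

theorem ae_tendsto_wordTrace {Ω : Type*} [MeasurableSpace Ω] (P : Measure Ω)
    [IsProbabilityMeasure P] (S : (n : ℕ) → ι → Ω → Matrix (Fin n) (Fin n) ℂ)
    (hS : ∀ n, IsGUEFamily (S n) P) (w : List ι)
    (hw : conj (semicircularMoment w) = semicircularMoment w.reverse) :
    ∀ᵐ ω ∂P, Tendsto (fun n => wordTrace (fun a => S n a ω) w) atTop
      (𝓝 (semicircularMoment w)) := by
  obtain ⟨C, hC⟩ := exists_integral_norm_sq_wordTrace_sub_le w hw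
  -- The shift to `n + 1` avoids dimension zero, where the moment bound is not available.
  have h := ae_tendsto_zero_of_summable_integral (P := P)
    (f := fun n ω => ‖wordTrace (fun a => S (n + 1) a ω) w - semicircularMoment w‖ ^ 2)
    (fun _ _ => by positivity) (fun n => (hC P (S (n + 1)) n.succ_pos (hS _)).1) (by
      refine Summable.of_nonneg_of_le (fun n => integral_nonneg fun ω => by positivity)
        (fun n => (hC P (S (n + 1)) n.succ_pos (hS _)).2) ?_
      simp only [div_eq_mul_inv]
      refine Summable.mul_left C ?_
      exact (summable_nat_add_iff 1).2 (Real.summable_nat_pow_inv.2 one_lt_two))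
  filter_upwards [h] with ω hω
  rw [← tendsto_add_atTop_iff_nat 1, tendsto_iff_norm_sub_tendsto_zero]
  simpa using hω.sqrt

theorem ae_tendsto_wordTrace_four {Ω : Type*} [MeasurableSpace Ω] (P : Measure Ω)
    [IsProbabilityMeasure P] (S : (n : ℕ) → ι → Ω → Matrix (Fin n) (Fin n) ℂ)
    (hS : ∀ n, IsGUEFamily (S n) P) :
    ∀ᵐ ω ∂P, ∀ a b c d, Tendsto
      (fun n : ℕ => (n : ℂ)⁻¹ * (S n a ω * S n b ω * S n c ω * S n d ω).trace) atTop
      (𝓝 ((if a = b then 1 else 0) * (if c = d then 1 else 0) +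
        (if a = d then 1 else 0) * (if b = c then 1 else 0))) := by
  simp only [ae_all_iff]
  intro a b c d
  filter_upwards [ae_tendsto_wordTrace P S hS [a, b, c, d] (by
    simp only [List.reverse_cons, List.reverse_nil, List.nil_append, List.cons_append,
      semicircularMoment_four]
    simp only [eq_comm (a := d) (b := c), eq_comm (a := b) (b := a), eq_comm (a := d) (b := a),
      eq_comm (a := c) (b := b)]
    split_ifs <;> simp)] with ω hω
  rw [← semicircularMoment_four]
  refine hω.congr fun n => ?_
  simp [wordTrace, wordProd, mul_assoc]

end AlmostSureConvergence

/-! ### Schatten norms: spectra, diagonals, convexity -/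

section SchattenNorm

open Matrix

theorem norm_toLp_top_le_of_filter_map_eq {m l : Type*} [Fintype m] [Fintype l] {f : m → ℝ}
    {g : l → ℝ}
    (h : (Finset.univ.val.map f).filter (· ≠ 0) = (Finset.univ.val.map g).filter (· ≠ 0)) :
    ‖WithLp.toLp ∞ f‖ ≤ ‖WithLp.toLp ∞ g‖ := by
  rw [PiLp.norm_eq_ciSup]
  refine Real.iSup_le (fun i => ?_) (norm_nonneg _)
  by_cases hi : f i = 0
  · simp [hi]
  · have : f i ∈ (Finset.univ.val.map g).filter (· ≠ 0) := by
      rw [← h]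
      simp [hi]
    obtain ⟨j, _, hj⟩ := Multiset.mem_map.1 (Multiset.mem_filter.1 this).1
    change ‖f i‖ ≤ _
    rw [← hj]
    exact PiLp.norm_apply_le (WithLp.toLp ∞ g) j

theorem sum_norm_rpow_eq {m : Type*} [Fintype m] (f : m → ℝ) {r : ℝ} (hr : r ≠ 0) :
    ∑ i, ‖f i‖ ^ r = (((Finset.univ.val.map f).filter (· ≠ 0)).map fun x => ‖x‖ ^ r).sum := by
  rw [← Finset.sum_filter_of_ne (p := fun i => f i ≠ 0), Multiset.filter_map, Multiset.map_map]
  · rfl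
  · intro i _ hi h
    rw [h, norm_zero, Real.zero_rpow hr] at hi
    exact hi rfl

/-- Zero entries do not affect an `ℓ^p` norm; this allows comparing matrices of different sizes. -/
theorem norm_toLp_eq_of_filter_map_eq {m l : Type*} [Fintype m] [Fintype l] (p : ℝ≥0∞)
    (hp : 1 ≤ p) {f : m → ℝ} {g : l → ℝ}
    (h : (Finset.univ.val.map f).filter (· ≠ 0) = (Finset.univ.val.map g).filter (· ≠ 0)) :
    ‖WithLp.toLp p f‖ = ‖WithLp.toLp p g‖ := by
  rcases eq_or_ne p ∞ with rfl | hp'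
  · exact le_antisymm (norm_toLp_top_le_of_filter_map_eq h)
      (norm_toLp_top_le_of_filter_map_eq h.symm)
  · have h0 : 0 < p.toReal := ENNReal.toReal_pos (by rintro rfl; simp at hp) hp'
    rw [PiLp.norm_eq_sum h0, PiLp.norm_eq_sum h0]
    change (∑ i, ‖f i‖ ^ p.toReal) ^ _ = (∑ i, ‖g i‖ ^ p.toReal) ^ _
    rw [sum_norm_rpow_eq f h0.ne', sum_norm_rpow_eq g h0.ne', h]

theorem map_eigenvalues {m : Type*} [Fintype m] [DecidableEq m] {A : Matrix m m ℂ}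
    (hA : A.IsHermitian) (f : ℝ → ℝ) :
    Finset.univ.val.map (fun i => f (hA.eigenvalues i)) =
      A.charpoly.roots.map fun z => f z.re := by
  rw [hA.roots_charpoly_eq_eigenvalues, Multiset.map_map]
  rfl

-- The powers of `X` only add zero eigenvalues, compensating for the difference in size.
open Polynomial in
theorem schattenNorm_eq_of_charpoly {m l : Type*} [Fintype m] [DecidableEq m] [Fintype l]
    [DecidableEq l] (p : ℝ≥0∞) (hp : 1 ≤ p) {A : Matrix m m ℂ} {B : Matrix l l ℂ} (a b : ℕ)
    (h : (X : ℂ[X]) ^ a * (Aᴴ * A).charpoly = X ^ b * (Bᴴ * B).charpoly) :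
    schattenNorm p A = schattenNorm p B := by
  refine norm_toLp_eq_of_filter_map_eq p hp ?_
  rw [map_eigenvalues _ Real.sqrt, map_eigenvalues _ Real.sqrt]
  have h1 : (Aᴴ * A).charpoly.roots.filter (· ≠ 0) = (Bᴴ * B).charpoly.roots.filter (· ≠ 0) := by
    have h2 := congrArg (fun q => q.roots.filter (· ≠ 0)) h
    rw [roots_mul (mul_ne_zero (pow_ne_zero _ X_ne_zero) (charpoly_monic _).ne_zero),
      roots_mul (mul_ne_zero (pow_ne_zero _ X_ne_zero) (charpoly_monic _).ne_zero)] at h2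
    have h3 : ∀ c : ℕ, (Multiset.replicate c (0 : ℂ)).filter (· ≠ 0) = 0 := fun c => by
      rw [Multiset.filter_eq_nil]
      intro x hx
      simp [Multiset.eq_of_mem_replicate hx]
    simpa only [roots_pow, roots_X, Multiset.nsmul_singleton, Multiset.filter_add, h3,
      zero_add] using h2
  -- A nonzero `z` may have `√z.re = 0`, so the outer filter has to stay.
  have h4 : ∀ s : Multiset ℂ, (s.map fun z => √z.re).filter (· ≠ 0) =
      ((s.filter (· ≠ 0)).map fun z => √z.re).filter (· ≠ 0) := fun s => by
    rw [Multiset.filter_map, Multiset.filter_map, Multiset.filter_filter]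
    congr 1
    refine Multiset.filter_congr fun z _ => ⟨fun hz => ⟨hz, ?_⟩, fun hz => hz.1⟩
    rintro rfl
    simp at hz
  rw [h4, h1, ← h4]

/-- `V * Vᴴ` and the transpose of `Vᴴ * V` have the same Schatten norms. -/
theorem schattenNorm_mul_conjTranspose {m l : Type*} [Fintype m] [DecidableEq m] [Fintype l]
    [DecidableEq l] (p : ℝ≥0∞) (hp : 1 ≤ p) (V : Matrix m l ℂ) :
    schattenNorm p (V * Vᴴ) = schattenNorm p (Vᵀ * (Vᵀ)ᴴ) := by
  refine schattenNorm_eq_of_charpoly p hp (Fintype.card l) (Fintype.card m) ?_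
  have h1 : (V * Vᴴ)ᴴ * (V * Vᴴ) = V * (Vᴴ * V * Vᴴ) := by
    simp [Matrix.mul_assoc]
  have h2 : (Vᵀ * (Vᵀ)ᴴ)ᴴ * (Vᵀ * (Vᵀ)ᴴ) = (Vᴴ * V * Vᴴ * V)ᵀ := by
    have h3 : (Vᵀ)ᴴ = (Vᴴ)ᵀ := by
      ext
      simp
    have h4 : ((Vᴴ)ᵀ)ᴴ = Vᵀ := by
      ext
      simp
    simp [Matrix.mul_assoc, h3, h4]
  rw [h1, h2, charpoly_transpose, charpoly_mul_comm']

theorem schattenNorm_eq_norm_eigenvalues {m : Type*} [Fintype m] [DecidableEq m] (p : ℝ≥0∞)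
    (hp : 1 ≤ p) {A : Matrix m m ℂ} (hA : A.PosSemidef) :
    schattenNorm p A = ‖WithLp.toLp p hA.isHermitian.eigenvalues‖ := by
  refine norm_toLp_eq_of_filter_map_eq p hp ?_
  have h1 : (Aᴴ * A).charpoly.roots =
      Finset.univ.val.map fun i => ((hA.isHermitian.eigenvalues i : ℂ)) ^ 2 := by
    have h2 : (Aᴴ * A).charpoly =
        (diagonal fun i => ((hA.isHermitian.eigenvalues i : ℂ)) ^ 2).charpoly := by
      rw [hA.isHermitian.eq]
      conv_lhs => rw [hA.isHermitian.spectral_theorem, ← map_mul, Unitary.conjStarAlgAut_apply,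
        charpoly_mul_comm, ← mul_assoc]
      simp [sq, Function.comp_def]
    rw [h2, charpoly_diagonal, Polynomial.roots_prod]
    · simp only [Polynomial.roots_X_sub_C]
      simp
    · exact Finset.prod_ne_zero_iff.2 fun i _ => Polynomial.X_sub_C_ne_zero _
  congr 1
  rw [map_eigenvalues _ Real.sqrt, h1, Multiset.map_map]
  refine Multiset.map_congr rfl fun i _ => ?_
  simp only [Function.comp_apply, ← Complex.ofReal_pow, Complex.ofReal_re]
  exact Real.sqrt_sq (hA.eigenvalues_nonneg i)

/-- By Birkhoff's theorem the matrix is a convex combination of permutations, each of which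
preserves the norm. -/
theorem norm_toLp_mulVec_le_of_mem_doublyStochastic {m : Type*} [Fintype m] [DecidableEq m]
    (p : ℝ≥0∞) (hp : 1 ≤ p) {M : Matrix m m ℝ} (hM : M ∈ doublyStochastic ℝ m) (d : m → ℝ) :
    ‖WithLp.toLp p (M *ᵥ d)‖ ≤ ‖WithLp.toLp p d‖ := by
  have : Fact (1 ≤ p) := ⟨hp⟩
  obtain ⟨w, hw0, hw1, rfl⟩ := exists_eq_sum_perm_of_mem_doublyStochastic hM
  have h1 : WithLp.toLp p ((∑ σ, w σ • σ.permMatrix ℝ) *ᵥ d) =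
      ∑ σ : Equiv.Perm m, w σ • WithLp.toLp p (d ∘ σ) := by
    rw [Matrix.sum_mulVec, WithLp.toLp_sum]
    refine Finset.sum_congr rfl fun σ _ => ?_
    rw [Matrix.smul_mulVec, WithLp.toLp_smul, Matrix.permMatrix_mulVec]
  have h2 : ∀ σ : Equiv.Perm m, ‖WithLp.toLp p (d ∘ σ)‖ = ‖WithLp.toLp p d‖ := fun σ => by
    refine norm_toLp_eq_of_filter_map_eq p hp ?_
    congr 1
    rw [← Multiset.map_map]
    congr 1
    simp
  rw [h1]
  refine (norm_sum_le _ _).trans (le_of_eq ?_)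
  simp only [norm_smul, h2, Real.norm_eq_abs, abs_of_nonneg (hw0 _)]
  rw [← Finset.sum_mul, hw1, one_mul]

theorem normSq_mem_doublyStochastic {m : Type*} [Fintype m] [DecidableEq m]
    {U : Matrix m m ℂ} (hU : U ∈ unitaryGroup m ℂ) :
    (Matrix.of fun i j => Complex.normSq (U i j)) ∈ doublyStochastic ℝ m := by
  rw [mem_doublyStochastic_iff_sum]
  refine ⟨fun i j => Complex.normSq_nonneg _, fun i => ?_, fun j => ?_⟩
  · have h := congrFun (congrFun (mem_unitaryGroup_iff.1 hU) i) i
    rw [Matrix.mul_apply, Matrix.one_apply_eq] at h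
    simp only [Matrix.star_apply, Complex.star_def, Complex.mul_conj] at h
    exact_mod_cast h
  · have h := congrFun (congrFun (mem_unitaryGroup_iff'.1 hU) j) j
    rw [Matrix.mul_apply, Matrix.one_apply_eq] at h
    simp only [Matrix.star_apply, Complex.star_def, mul_comm (conj _), Complex.mul_conj] at h
    exact_mod_cast h

/-- The diagonal of a positive semidefinite matrix in any orthonormal basis has `ℓ^p` norm at most
the Schatten `p`-norm. -/
theorem norm_diag_le_schattenNorm {m : Type*} [Fintype m] [DecidableEq m] (p : ℝ≥0∞) (hp : 1 ≤ p)
    {A : Matrix m m ℂ} (hA : A.PosSemidef) {U : Matrix m m ℂ} (hU : U ∈ unitaryGroup m ℂ) :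
    ‖WithLp.toLp p fun j => ((Uᴴ * A * U) j j).re‖ ≤ schattenNorm p A := by
  rw [schattenNorm_eq_norm_eigenvalues p hp hA]
  set d := hA.isHermitian.eigenvalues
  set W := hA.isHermitian.eigenvectorUnitary
  have hQ : Uᴴ * (W : Matrix m m ℂ) ∈ unitaryGroup m ℂ := mul_mem (Unitary.star_mem hU) W.2
  set Q := Uᴴ * (W : Matrix m m ℂ) with hQdef
  have h1 : Uᴴ * A * U = Q * diagonal (fun i => (d i : ℂ)) * Qᴴ := by
    conv_lhs => rw [hA.isHermitian.spectral_theorem, Unitary.conjStarAlgAut_apply]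
    rw [hQdef, Matrix.conjTranspose_mul, Matrix.conjTranspose_conjTranspose]
    simp only [Matrix.mul_assoc]
    rfl
  -- The Schur–Horn argument: the diagonal is a unistochastic matrix applied to the eigenvalues.
  have h2 : (fun j => ((Uᴴ * A * U) j j).re) =
      (Matrix.of fun i j => Complex.normSq (Q i j)) *ᵥ d := by
    funext j
    rw [h1, Matrix.mul_apply, Matrix.mulVec, dotProduct, Complex.re_sum]
    refine Finset.sum_congr rfl fun l _ => ?_
    rw [Matrix.mul_diagonal, Matrix.conjTranspose_apply, mul_right_comm, Complex.star_def,
      Complex.mul_conj, ← Complex.ofReal_mul, Complex.ofReal_re, Matrix.of_apply]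
  rw [h2]
  exact norm_toLp_mulVec_le_of_mem_doublyStochastic p hp (normSq_mem_doublyStochastic hQ) d

/-- An eigenbasis attains the bound of `norm_diag_le_schattenNorm`, so on positive semidefinite
matrices the Schatten norm is a maximum of seminorms of `A`; convexity follows. -/
theorem exists_unitary_norm_diag_eq_schattenNorm {m : Type*} [Fintype m] [DecidableEq m]
    (p : ℝ≥0∞) (hp : 1 ≤ p) {A : Matrix m m ℂ} (hA : A.PosSemidef) :
    ∃ U ∈ unitaryGroup m ℂ, ‖WithLp.toLp p fun j => ((Uᴴ * A * U) j j).re‖ = schattenNorm p A := by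
  refine ⟨hA.isHermitian.eigenvectorUnitary, hA.isHermitian.eigenvectorUnitary.2, ?_⟩
  rw [schattenNorm_eq_norm_eigenvalues p hp hA]
  congr 2
  funext j
  have h := hA.isHermitian.conjStarAlgAut_star_eigenvectorUnitary
  rw [Unitary.conjStarAlgAut_star_apply] at h
  rw [← Matrix.star_eq_conjTranspose, h, Matrix.diagonal_apply_eq]
  simp

/-- The Schatten norm is convex on positive semidefinite matrices. -/
theorem schattenNorm_sum_smul_le {m s : Type*} [Fintype m] [DecidableEq m] [Fintype s]
    (p : ℝ≥0∞) (hp : 1 ≤ p) {A : s → Matrix m m ℂ} (hA : ∀ i, (A i).PosSemidef) {c : s → ℝ}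
    (hc : ∀ i, 0 ≤ c i) :
    schattenNorm p (∑ i, (c i : ℂ) • A i) ≤ ∑ i, c i * schattenNorm p (A i) := by
  have : Fact (1 ≤ p) := ⟨hp⟩
  have hpos : (∑ i, (c i : ℂ) • A i).PosSemidef :=
    posSemidef_sum _ fun i _ => (hA i).smul (by exact_mod_cast hc i)
  obtain ⟨U, hU, hUn⟩ := exists_unitary_norm_diag_eq_schattenNorm p hp hpos
  have h1 : (WithLp.toLp p fun j => ((Uᴴ * (∑ i, (c i : ℂ) • A i) * U) j j).re) =
      ∑ i, c i • WithLp.toLp p fun j => ((Uᴴ * A i * U) j j).re := by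
    simp only [← WithLp.toLp_smul, ← WithLp.toLp_sum]
    congr 1
    funext j
    simp [Matrix.mul_sum, Matrix.sum_mul, Matrix.sum_apply]
  rw [← hUn, h1]
  refine (norm_sum_le _ _).trans (Finset.sum_le_sum fun i _ => ?_)
  rw [norm_smul, Real.norm_eq_abs, abs_of_nonneg (hc i)]
  exact mul_le_mul_of_nonneg_left (norm_diag_le_schattenNorm p hp (hA i) hU) (hc i)

theorem ketbra_posSemidef {m : Type*} [Finite m] (v : m → ℂ) : (ketbra v).PosSemidef :=
  posSemidef_vecMulVec_self_star v

theorem trace_ketbra {m : Type*} [Fintype m] (v : m → ℂ) : (ketbra v).trace = v ⬝ᵥ star v :=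
  trace_vecMulVec v (star v)

theorem exists_eq_sum_ketbra_of_mem_quantumStates {m : Type*} [Fintype m] [DecidableEq m]
    {ρ : Matrix m m ℂ} (hρ : ρ ∈ quantumStates m) :
    ∃ (c : m → ℝ) (v : m → m → ℂ), (∀ i, 0 ≤ c i) ∧ ∑ i, c i = 1 ∧
      (∀ i, ketbra (v i) ∈ quantumStates m) ∧ ρ = ∑ i, (c i : ℂ) • ketbra (v i) := by
  obtain ⟨hpos, htr⟩ := hρ
  set W := hpos.isHermitian.eigenvectorUnitary
  refine ⟨hpos.isHermitian.eigenvalues, fun i x => (W : Matrix m m ℂ) x i,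
    hpos.eigenvalues_nonneg, ?_, fun i => ⟨ketbra_posSemidef _, ?_⟩, ?_⟩
  · rw [hpos.isHermitian.trace_eq_sum_eigenvalues] at htr
    simpa using congrArg Complex.re htr
  · have h := congrFun (congrFun (mem_unitaryGroup_iff'.1 W.2) i) i
    rw [Matrix.mul_apply, Matrix.one_apply_eq] at h
    rw [trace_ketbra, ← h, dotProduct]
    exact Finset.sum_congr rfl fun x _ => mul_comm _ _
  · ext x y
    conv_lhs => rw [hpos.isHermitian.spectral_theorem, Unitary.conjStarAlgAut_apply]
    rw [Matrix.mul_apply, Matrix.sum_apply]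
    refine Finset.sum_congr rfl fun i _ => ?_
    rw [Matrix.mul_diagonal, Matrix.smul_apply, ketbra, Matrix.vecMulVec_apply, smul_eq_mul,
      ← mul_assoc, mul_comm (Complex.ofReal _)]
    rfl

/-- A state is a convex combination of pure states, so by convexity its output norm under `Φ` is at
most an average of pure output norms, which are shared with `Ψ`. -/
theorem maxOutputNorm_le_of_ketbra {m l l' : Type*} [Fintype m] [DecidableEq m] [Fintype l]
    [DecidableEq l] [Fintype l'] [DecidableEq l'] (p : ℝ≥0∞) (hp : 1 ≤ p)
    (Φ : Matrix m m ℂ →ₗ[ℂ] Matrix l l ℂ) (Ψ : Matrix m m ℂ →ₗ[ℂ] Matrix l' l' ℂ)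
    (hΦ : ∀ v, (Φ (ketbra v)).PosSemidef)
    (h : ∀ v, schattenNorm p (Φ (ketbra v)) = schattenNorm p (Ψ (ketbra v))) :
    maxOutputNorm p Φ ≤ maxOutputNorm p Ψ := by
  refine iSup₂_le fun ρ hρ => ?_
  obtain ⟨c, v, hc0, hc1, hv, rfl⟩ := exists_eq_sum_ketbra_of_mem_quantumStates hρ
  have hnn : ∀ B : Matrix l l ℂ, 0 ≤ schattenNorm p B := fun B => by
    have : Fact (1 ≤ p) := ⟨hp⟩
    exact norm_nonneg _
  simp only [map_sum, map_smul]
  refine (ENNReal.ofReal_le_ofReal (schattenNorm_sum_smul_le p hp (fun i => hΦ (v i)) hc0)).trans ?_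
  rw [ENNReal.ofReal_sum_of_nonneg fun i _ => mul_nonneg (hc0 i) (hnn _)]
  calc ∑ i, ENNReal.ofReal (c i * schattenNorm p (Φ (ketbra (v i))))
      ≤ ∑ i, ENNReal.ofReal (c i) * maxOutputNorm p Ψ := Finset.sum_le_sum fun i _ => by
        rw [ENNReal.ofReal_mul (hc0 i), h]
        gcongr
        exact le_iSup₂ (f := fun ρ (_ : ρ ∈ quantumStates m) =>
          ENNReal.ofReal (schattenNorm p (Ψ ρ))) _ (hv i)
    _ = maxOutputNorm p Ψ := by
        rw [← Finset.sum_mul, ← ENNReal.ofReal_sum_of_nonneg fun i _ => hc0 i, hc1,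
          ENNReal.ofReal_one, one_mul]

end SchattenNorm

/-! ### Tensor products of the maps and their values on pure states -/

section TensorMap

open Matrix

theorem linearMap_ext_kronecker {a b V : Type*} [Fintype a] [DecidableEq a] [Fintype b]
    [DecidableEq b] [AddCommGroup V] [Module ℂ V] {F G : Matrix (a × b) (a × b) ℂ →ₗ[ℂ] V}
    (h : ∀ A B, F (A ⊗ₖ B) = G (A ⊗ₖ B)) : F = G := by
  refine Matrix.ext_linearMap _ fun i j => LinearMap.ext fun c => ?_
  have h1 : single i j c = single i.1 j.1 c ⊗ₖ single i.2 j.2 (1 : ℂ) := by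
    rw [single_kronecker_single, mul_one]
  simp only [LinearMap.comp_apply, Matrix.singleLinearMap_apply]
  rw [h1, h]

variable {k : ℕ} {m : Type*} [Fintype m] [DecidableEq m]

theorem tensorMap_cpMap_apply (X Y : Fin k → Matrix m m ℂ) (ρ : Matrix (m × m) (m × m) ℂ) :
    tensorMap (cpMap X) (cpMap Y) ρ = ((k : ℂ)⁻¹ * (k : ℂ)⁻¹) •
      ∑ s : Fin k × Fin k, (X s.1 ⊗ₖ Y s.2) * ρ * (X s.1 ⊗ₖ Y s.2)ᴴ := by
  let G : Matrix (m × m) (m × m) ℂ →ₗ[ℂ] Matrix (m × m) (m × m) ℂ :=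
    ((k : ℂ)⁻¹ * (k : ℂ)⁻¹) • ∑ s : Fin k × Fin k,
      LinearMap.mulRight ℂ (X s.1 ⊗ₖ Y s.2)ᴴ ∘ₗ LinearMap.mulLeft ℂ (X s.1 ⊗ₖ Y s.2)
  have hG : tensorMap (cpMap X) (cpMap Y) = G := linearMap_ext_kronecker fun A B => by
    rw [tensorMap_kronecker]
    simp only [G, cpMap, LinearMap.coe_mk, AddHom.coe_mk, LinearMap.smul_apply,
      LinearMap.sum_apply, LinearMap.comp_apply, LinearMap.mulLeft_apply, LinearMap.mulRight_apply,
      conjTranspose_kronecker, ← mul_kronecker_mul]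
    rw [smul_kronecker, kronecker_smul, smul_smul, Fintype.sum_prod_type]
    congr 1
    ext ⟨i, i'⟩ ⟨j, j'⟩
    simp only [kronecker_apply, Matrix.sum_apply, Finset.sum_mul_sum]
  rw [hG]
  simp [G]

theorem tensorMap_complMap_apply (X Y : Fin k → Matrix m m ℂ) (ρ : Matrix (m × m) (m × m) ℂ)
    (s t : Fin k × Fin k) :
    tensorMap (complMap X) (complMap Y) ρ s t = ((k : ℂ)⁻¹ * (k : ℂ)⁻¹) *
      ((X s.1 ⊗ₖ Y s.2) * ρ * (X t.1 ⊗ₖ Y t.2)ᴴ).trace := by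
  let F : Matrix (m × m) (m × m) ℂ →ₗ[ℂ] ℂ :=
    Matrix.entryLinearMap ℂ ℂ s t ∘ₗ tensorMap (complMap X) (complMap Y)
  let G : Matrix (m × m) (m × m) ℂ →ₗ[ℂ] ℂ :=
    ((k : ℂ)⁻¹ * (k : ℂ)⁻¹) • (Matrix.traceLinearMap (m × m) ℂ ℂ ∘ₗ
      LinearMap.mulRight ℂ (X t.1 ⊗ₖ Y t.2)ᴴ ∘ₗ LinearMap.mulLeft ℂ (X s.1 ⊗ₖ Y s.2))
  have hG : F = G := linearMap_ext_kronecker fun A B => by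
    simp only [F, G, LinearMap.comp_apply, LinearMap.smul_apply, LinearMap.mulLeft_apply,
      LinearMap.mulRight_apply, conjTranspose_kronecker, ← mul_kronecker_mul,
      tensorMap_kronecker, Matrix.traceLinearMap_apply, Matrix.entryLinearMap_apply,
      trace_kronecker, kroneckerMap_apply, complMap, LinearMap.coe_mk, AddHom.coe_mk,
      Matrix.smul_apply, Matrix.of_apply, smul_eq_mul]
    ring
  exact LinearMap.congr_fun hG ρ

/-- The matrix of the images of `v` under the operators `X i ⊗ Y j`, scaled by `1 / k`. -/
noncomputable def krausImages (X Y : Fin k → Matrix m m ℂ) (v : m × m → ℂ) :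
    Matrix (m × m) (Fin k × Fin k) ℂ :=
  Matrix.of fun x s => (k : ℂ)⁻¹ * ((X s.1 ⊗ₖ Y s.2) *ᵥ v) x

omit [DecidableEq m] in
theorem mul_ketbra_mul_conjTranspose {l l' : Type*} (A : Matrix l m ℂ)
    (B : Matrix l' m ℂ) (v : m → ℂ) :
    A * ketbra v * Bᴴ = vecMulVec (A *ᵥ v) (star (B *ᵥ v)) := by
  rw [ketbra, mul_vecMulVec, vecMulVec_mul, star_mulVec]

theorem tensorMap_cpMap_ketbra (X Y : Fin k → Matrix m m ℂ) (v : m × m → ℂ) :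
    tensorMap (cpMap X) (cpMap Y) (ketbra v) = krausImages X Y v * (krausImages X Y v)ᴴ := by
  ext x y
  rw [tensorMap_cpMap_apply, Matrix.smul_apply, Matrix.sum_apply, Matrix.mul_apply, smul_eq_mul,
    Finset.mul_sum]
  refine Finset.sum_congr rfl fun s _ => ?_
  rw [mul_ketbra_mul_conjTranspose, vecMulVec_apply, conjTranspose_apply, krausImages, of_apply,
    of_apply, star_mul', Pi.star_apply]
  simp only [Complex.star_def, map_inv₀, map_natCast]
  ring

theorem tensorMap_complMap_ketbra (X Y : Fin k → Matrix m m ℂ) (v : m × m → ℂ) :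
    tensorMap (complMap X) (complMap Y) (ketbra v) =
      (krausImages X Y v)ᵀ * ((krausImages X Y v)ᵀ)ᴴ := by
  ext s t
  rw [tensorMap_complMap_apply, mul_ketbra_mul_conjTranspose, trace_vecMulVec, dotProduct,
    Matrix.mul_apply, Finset.mul_sum]
  refine Finset.sum_congr rfl fun x _ => ?_
  rw [conjTranspose_apply, transpose_apply, transpose_apply, krausImages, of_apply, of_apply,
    star_mul', Pi.star_apply]
  simp only [Complex.star_def, map_inv₀, map_natCast]
  ring

/-- With `V = krausImages X Y v`, the two outputs on `ketbra v` are `V Vᴴ` and `(Vᴴ V)ᵀ`. -/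
theorem maxOutputNorm_cpMap_eq_complMap (p : ℝ≥0∞) (hp : 1 ≤ p) (X Y : Fin k → Matrix m m ℂ) :
    maxOutputNorm p (tensorMap (cpMap X) (cpMap Y)) =
      maxOutputNorm p (tensorMap (complMap X) (complMap Y)) := by
  have h : ∀ v, schattenNorm p (tensorMap (cpMap X) (cpMap Y) (ketbra v)) =
      schattenNorm p (tensorMap (complMap X) (complMap Y) (ketbra v)) := fun v => by
    rw [tensorMap_cpMap_ketbra, tensorMap_complMap_ketbra, schattenNorm_mul_conjTranspose p hp]
  refine le_antisymm (maxOutputNorm_le_of_ketbra p hp _ _ (fun v => ?_) h)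
    (maxOutputNorm_le_of_ketbra p hp _ _ (fun v => ?_) fun v => (h v).symm)
  · rw [tensorMap_cpMap_ketbra]
    exact posSemidef_self_mul_conjTranspose _
  · rw [tensorMap_complMap_ketbra]
    exact posSemidef_self_mul_conjTranspose _

theorem dotProduct_star_bellState {n : ℕ} (hn : 0 < n) :
    bellState n ⬝ᵥ star (bellState n) = 1 := by
  have hn' : (n : ℂ) ≠ 0 := by exact_mod_cast hn.ne'
  simp only [dotProduct, Fintype.sum_prod_type, bellState, Pi.star_apply]
  simp only [apply_ite (star : ℂ → ℂ), star_zero, mul_ite, ite_mul, zero_mul, mul_zero,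
    Finset.sum_ite_eq, Finset.mem_univ, if_true, Complex.star_def, map_inv₀, Complex.conj_ofReal,
    Finset.sum_const, Finset.card_univ, Fintype.card_fin, nsmul_eq_mul]
  rw [← mul_inv, ← Complex.ofReal_mul, Real.mul_self_sqrt (Nat.cast_nonneg n),
    Complex.ofReal_natCast, mul_inv_cancel₀ hn']

theorem ketbra_bellState_mem_quantumStates {n : ℕ} (hn : 0 < n) :
    ketbra (bellState n) ∈ quantumStates (Fin n × Fin n) :=
  ⟨ketbra_posSemidef _, by rw [trace_ketbra, dotProduct_star_bellState hn]⟩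

theorem kronecker_conj_mulVec_bellState {n : ℕ} (A B : Matrix (Fin n) (Fin n) ℂ)
    (x : Fin n × Fin n) :
    ((A ⊗ₖ B.map conj) *ᵥ bellState n) x = ((√(n : ℝ) : ℝ) : ℂ)⁻¹ * (A * Bᴴ) x.1 x.2 := by
  simp only [mulVec, dotProduct, Fintype.sum_prod_type, bellState, mul_ite,
    mul_zero, Finset.sum_ite_eq, Finset.mem_univ, if_true, Matrix.mul_apply, Finset.mul_sum,
    conjTranspose_apply]
  refine Finset.sum_congr rfl fun a _ => ?_
  rw [mul_comm]
  rfl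

/-- The entry is a Hilbert–Schmidt inner product of `X s.1 (X s.2)ᴴ` and `X t.1 (X t.2)ᴴ`; the
adjoint of the latter reverses the order of the `t` indices. -/
theorem tensorMap_complMap_bellState {n : ℕ} (X : Fin k → Matrix (Fin n) (Fin n) ℂ)
    (s t : Fin k × Fin k) :
    tensorMap (complMap X) (complMap (conjFam X)) (ketbra (bellState n)) s t =
      ((k : ℂ) ^ 2)⁻¹ * ((n : ℂ)⁻¹ * (X s.1 * (X s.2)ᴴ * X t.2 * (X t.1)ᴴ).trace) := by
  have h1 : (X s.1 * (X s.2)ᴴ * X t.2 * (X t.1)ᴴ) = (X s.1 * (X s.2)ᴴ) * (X t.1 * (X t.2)ᴴ)ᴴ := by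
    rw [conjTranspose_mul, conjTranspose_conjTranspose, Matrix.mul_assoc, Matrix.mul_assoc]
  rw [tensorMap_complMap_apply, mul_ketbra_mul_conjTranspose, trace_vecMulVec, h1, sq, mul_inv]
  congr 1
  simp only [dotProduct, Pi.star_apply, conjFam, kronecker_conj_mulVec_bellState,
    Fintype.sum_prod_type, Matrix.trace, Matrix.diag_apply, Matrix.mul_apply (M := X s.1 * (X s.2)ᴴ),
    conjTranspose_apply, Finset.mul_sum]
  refine Finset.sum_congr rfl fun x _ => Finset.sum_congr rfl fun y _ => ?_
  have h2 : (n : ℂ)⁻¹ = ((√(n : ℝ) : ℝ) : ℂ)⁻¹ * ((√(n : ℝ) : ℝ) : ℂ)⁻¹ := by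
    rw [← mul_inv, ← Complex.ofReal_mul, Real.mul_self_sqrt (Nat.cast_nonneg n),
      Complex.ofReal_natCast]
  rw [star_mul', h2]
  simp only [Complex.star_def, map_inv₀, Complex.conj_ofReal]
  ring

end TensorMap

/-! ### The lower bound from the Bell state -/

section LowerBound

open Matrix

theorem exists_unitary_col_eq {m : Type*} [Fintype m] [DecidableEq m] {v : m → ℂ}
    (hv : v ⬝ᵥ star v = 1) (i : m) : ∃ U ∈ unitaryGroup m ℂ, ∀ x, U x i = v x := by
  have hnorm : ‖(WithLp.toLp 2 v : EuclideanSpace ℂ m)‖ = 1 := by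
    have h : inner ℂ (WithLp.toLp 2 v : EuclideanSpace ℂ m) (WithLp.toLp 2 v) = 1 := by
      rw [EuclideanSpace.inner_eq_star_dotProduct]
      exact hv
    rw [inner_self_eq_norm_sq_to_K] at h
    have h' : ‖(WithLp.toLp 2 v : EuclideanSpace ℂ m)‖ ^ 2 = 1 :=
      Complex.ofReal_injective (by simpa using h)
    nlinarith [norm_nonneg (WithLp.toLp 2 v : EuclideanSpace ℂ m)]
  obtain ⟨b, hb⟩ := Orthonormal.exists_orthonormalBasis_extension_of_card_eq (𝕜 := ℂ)
    (E := EuclideanSpace ℂ m) (by simp) (s := {i}) (v := fun _ : m => WithLp.toLp 2 v)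
    ⟨fun _ => hnorm, fun a c hac => (hac (Subsingleton.elim _ _)).elim⟩
  refine ⟨Matrix.of fun x j => b j x, ?_, fun x => ?_⟩
  · rw [mem_unitaryGroup_iff']
    ext j l
    have h := orthonormal_iff_ite.1 b.orthonormal j l
    rw [EuclideanSpace.inner_eq_star_dotProduct] at h
    rw [Matrix.mul_apply, Matrix.one_apply, ← h, dotProduct]
    exact Finset.sum_congr rfl fun x _ => mul_comm _ _
  · rw [Matrix.of_apply, hb i rfl]

theorem diag_conj_unitary_rank_one {m : Type*} [Fintype m] [DecidableEq m] {v : m → ℂ}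
    {U : Matrix m m ℂ} (hU : U ∈ unitaryGroup m ℂ) {i : m} (hi : ∀ x, U x i = v x) (a b : ℂ)
    (j : m) :
    (Uᴴ * (a • (1 : Matrix m m ℂ) + b • ketbra v) * U) j j = if j = i then a + b else a := by
  have h1 : Uᴴ * U = 1 := mem_unitaryGroup_iff'.1 hU
  have h2 : ∀ l, (Uᴴ *ᵥ v) l = if l = i then 1 else 0 := fun l => by
    rw [← Matrix.one_apply, ← h1, Matrix.mul_apply, mulVec, dotProduct]
    simp only [hi]
  have h3 : Uᴴ * ketbra v * U = vecMulVec (Uᴴ *ᵥ v) (star (Uᴴ *ᵥ v)) := by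
    simpa using mul_ketbra_mul_conjTranspose Uᴴ Uᴴ v
  rw [Matrix.mul_add, Matrix.add_mul, Matrix.mul_smul, Matrix.smul_mul, Matrix.mul_one, h1,
    Matrix.mul_smul, Matrix.smul_mul, h3]
  simp only [Matrix.add_apply, Matrix.smul_apply, Matrix.one_apply_eq, vecMulVec_apply,
    Pi.star_apply, h2]
  split_ifs <;> simp

/-- A unitary with column `b_k` diagonalizes the limit. Keeping it fixed, the norm of the diagonal
is a continuous lower bound for the Schatten norm, so no continuity of eigenvalues is needed. -/
theorem ofReal_norm_le_liminf_maxOutputNorm {k : ℕ} (hk : 0 < k)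
    (X : (n : ℕ) → Fin k → Matrix (Fin n) (Fin n) ℂ)
    (hX : Tendsto (fun n => tensorMap (complMap (X n)) (complMap (conjFam (X n)))
      (ketbra (bellState n))) atTop
      (𝓝 (((k : ℂ) ^ 2)⁻¹ • (1 : Matrix (Fin k × Fin k) (Fin k × Fin k) ℂ)
        + (k : ℂ)⁻¹ • ketbra (bellState k))))
    (p : ℝ≥0∞) (hp : 1 ≤ p) (i : Fin k × Fin k) :
    ENNReal.ofReal ‖WithLp.toLp p fun j : Fin k × Fin k =>
      if j = i then 1 / (k : ℝ) + 1 / (k : ℝ) ^ 2 else 1 / (k : ℝ) ^ 2‖ ≤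
    liminf (fun n => maxOutputNorm p
      (tensorMap (cpMap (X n)) (cpMap (conjFam (X n))))) atTop := by
  have : Fact (1 ≤ p) := ⟨hp⟩
  obtain ⟨U, hU, hUi⟩ := exists_unitary_col_eq (dotProduct_star_bellState hk) i
  set A := fun n => tensorMap (complMap (X n)) (complMap (conjFam (X n))) (ketbra (bellState n))
  have hcont : Continuous fun B : Matrix (Fin k × Fin k) (Fin k × Fin k) ℂ =>
      ENNReal.ofReal ‖WithLp.toLp p fun j => ((Uᴴ * B * U) j j).re‖ := by
    refine ENNReal.continuous_ofReal.comp (continuous_norm.comp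
      ((PiLp.continuous_toLp p _).comp (continuous_pi fun j => Complex.continuous_re.comp ?_)))
    exact ((continuous_const.matrix_mul continuous_id).matrix_mul continuous_const).matrix_elem j j
  have hlim := (hcont.tendsto _).comp hX
  have hval : (fun j => ((Uᴴ * (((k : ℂ) ^ 2)⁻¹ • (1 : Matrix (Fin k × Fin k) (Fin k × Fin k) ℂ)
        + (k : ℂ)⁻¹ • ketbra (bellState k)) * U) j j).re) =
      fun j => if j = i then 1 / (k : ℝ) + 1 / (k : ℝ) ^ 2 else 1 / (k : ℝ) ^ 2 := by
    funext j
    have e1 : ((k : ℂ) ^ 2)⁻¹ = ((1 / (k : ℝ) ^ 2 : ℝ) : ℂ) := by push_cast; rw [one_div]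
    have e2 : (k : ℂ)⁻¹ = ((1 / (k : ℝ) : ℝ) : ℂ) := by push_cast; rw [one_div]
    rw [diag_conj_unitary_rank_one hU hUi, e1, e2, ← Complex.ofReal_add]
    split_ifs
    · rw [Complex.ofReal_re, add_comm]
    · rw [Complex.ofReal_re]
  rw [hval] at hlim
  rw [← hlim.liminf_eq]
  refine liminf_le_liminf ?_
  -- For `n = 0` the Bell vector is empty and does not give a state.
  filter_upwards [eventually_gt_atTop 0] with n hn
  rw [maxOutputNorm_cpMap_eq_complMap p hp]
  have hpos : (A n).PosSemidef := by
    simp only [A, tensorMap_complMap_ketbra]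
    exact posSemidef_self_mul_conjTranspose _
  exact (ENNReal.ofReal_le_ofReal (norm_diag_le_schattenNorm p hp hpos hU)).trans
    (le_iSup₂ (f := fun ρ (_ : ρ ∈ quantumStates (Fin n × Fin n)) => ENNReal.ofReal
      (schattenNorm p (tensorMap (complMap (X n)) (complMap (conjFam (X n))) ρ))) _
      (ketbra_bellState_mem_quantumStates hn))

theorem norm_toLp_ite_const {m : Type*} [Fintype m] [DecidableEq m] (i : m) {a b : ℝ}
    (ha : 0 ≤ a) (hb : 0 ≤ b) {p : ℝ} (hp : 1 ≤ p) :
    ‖WithLp.toLp (ENNReal.ofReal p) fun j => if j = i then a else b‖ =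
      (a ^ p + ((Fintype.card m : ℝ) - 1) * b ^ p) ^ (1 / p) := by
  have hp0 : 0 ≤ p := zero_le_one.trans hp
  have hpr : (ENNReal.ofReal p).toReal = p := ENNReal.toReal_ofReal hp0
  rw [PiLp.norm_eq_sum (by rw [hpr]; linarith), hpr]
  congr 1
  rw [← Finset.add_sum_erase _ _ (Finset.mem_univ i)]
  have h1 : ∀ j ∈ Finset.univ.erase i, ‖(WithLp.toLp (ENNReal.ofReal p) fun j =>
      if j = i then a else b) j‖ ^ p = b ^ p := fun j hj => by
    simp [Finset.ne_of_mem_erase hj, abs_of_nonneg hb]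
  rw [Finset.sum_congr rfl h1, Finset.sum_const, Finset.card_erase_of_mem (Finset.mem_univ i),
    Finset.card_univ, nsmul_eq_mul, Nat.cast_pred (Fintype.card_pos_iff.2 ⟨i⟩)]
  simp [abs_of_nonneg ha]

end LowerBound

/-! ### Fourth moments and the limiting output -/

section Limit

/-- Multilinearity expands the trace into sixteen GUE traces. Both noncrossing pairings match an `X`
with an `Xᴴ`, so the limit is the same as for GUEs. -/
theorem ae_tendsto_trace_of_isGinibreFamily {Ω : Type*} [MeasurableSpace Ω] (P : Measure Ω)
    [IsProbabilityMeasure P] {k : ℕ} (X : (n : ℕ) → Fin k → Ω → Matrix (Fin n) (Fin n) ℂ)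
    (hX : ∀ n, IsGinibreFamily (X n) P) :
    ∀ᵐ ω ∂P, ∀ a b c d, Tendsto
      (fun n : ℕ => (n : ℂ)⁻¹ * (X n a ω * (X n b ω)ᴴ * X n c ω * (X n d ω)ᴴ).trace) atTop
      (𝓝 ((if a = b then 1 else 0) * (if c = d then 1 else 0) +
        (if a = d then 1 else 0) * (if b = c then 1 else 0))) := by
  choose S hS hXS using hX
  filter_upwards [ae_tendsto_wordTrace_four P S hS,
    ae_all_iff.2 fun n => ae_all_iff.2 (hS n).isHermitian] with ω hω hH a b c d
  set r : ℂ := ((√2 : ℝ) : ℂ)⁻¹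
  have hr : r * r = 2⁻¹ := ofReal_sqrt_two_inv_mul_self
  let e : Bool → Fin k → Fin k ⊕ Fin k := fun s i => if s then Sum.inl i else Sum.inr i
  let u : Bool → ℂ := fun s => if s then r else r * Complex.I
  let u' : Bool → ℂ := fun s => if s then r else -(r * Complex.I)
  have h1 : ∀ n i, X n i ω = ∑ s, u s • S n (e s i) ω := fun n i => by
    rw [hXS, Fintype.sum_bool, smul_add, smul_smul]
    rfl
  have h2 : ∀ n i, (X n i ω)ᴴ = ∑ s, u' s • S n (e s i) ω := fun n i => by
    rw [h1, Matrix.conjTranspose_sum]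
    refine Finset.sum_congr rfl fun s _ => ?_
    rw [Matrix.conjTranspose_smul, (hH n _).eq]
    congr 1
    cases s <;> simp [u, u', r]
  have h3 : ∀ n : ℕ, (n : ℂ)⁻¹ * (X n a ω * (X n b ω)ᴴ * X n c ω * (X n d ω)ᴴ).trace =
      ∑ s₁, ∑ s₂, ∑ s₃, ∑ s₄, (u s₁ * u' s₂ * u s₃ * u' s₄) *
        ((n : ℂ)⁻¹ * (S n (e s₁ a) ω * S n (e s₂ b) ω * S n (e s₃ c) ω *
          S n (e s₄ d) ω).trace) := fun n => by
    rw [h2, h2, h1, h1]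
    simp only [Fintype.sum_bool, Matrix.add_mul, Matrix.mul_add, Matrix.trace_add,
      Matrix.smul_mul, Matrix.mul_smul, Matrix.trace_smul, smul_eq_mul]
    ring
  have h4 := tendsto_finsetSum Finset.univ fun s₁ _ => tendsto_finsetSum Finset.univ fun s₂ _ =>
    tendsto_finsetSum Finset.univ fun s₃ _ => tendsto_finsetSum Finset.univ fun s₄ _ =>
      (hω (e s₁ a) (e s₂ b) (e s₃ c) (e s₄ d)).const_mul (u s₁ * u' s₂ * u s₃ * u' s₄)
  -- Each matched pair contributes `∑ s, u s * u' s = 1/2 + 1/2`, and a pairing has two pairs.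
  have h5 : (r * r - r * Complex.I * (r * Complex.I)) ^ 2 = 1 := by
    linear_combination (r * r * (1 - Complex.I * Complex.I) ^ 2 + 2⁻¹ *
      (1 - Complex.I * Complex.I) ^ 2) * hr + 4⁻¹ * (Complex.I * Complex.I - 3) * Complex.I_mul_I
  simp only [h3]
  convert! h4 using 2
  simp only [e, u, u', Fintype.sum_bool, if_true, Bool.false_eq_true, if_false, Sum.inl.injEq,
    Sum.inr.injEq, reduceCtorEq]
  linear_combination -((if a = b then 1 else 0) * (if c = d then 1 else 0) +
    (if a = d then 1 else 0) * (if b = c then 1 else 0)) * h5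

theorem ae_tendsto_trace {Ω : Type*} [MeasurableSpace Ω] (P : Measure Ω)
    [IsProbabilityMeasure P] {k : ℕ} (X : (n : ℕ) → Fin k → Ω → Matrix (Fin n) (Fin n) ℂ)
    (hX : (∀ n, IsGUEFamily (X n) P) ∨ (∀ n, IsGinibreFamily (X n) P)) :
    ∀ᵐ ω ∂P, ∀ a b c d, Tendsto
      (fun n : ℕ => (n : ℂ)⁻¹ * (X n a ω * (X n b ω)ᴴ * X n c ω * (X n d ω)ᴴ).trace) atTop
      (𝓝 ((if a = b then 1 else 0) * (if c = d then 1 else 0) +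
        (if a = d then 1 else 0) * (if b = c then 1 else 0))) := by
  rcases hX with hX | hX
  · filter_upwards [ae_tendsto_wordTrace_four P X hX,
      ae_all_iff.2 fun n => ae_all_iff.2 (hX n).isHermitian] with ω hω hH a b c d
    simpa only [(hH _ _).eq] using hω a b c d
  · exact ae_tendsto_trace_of_isGinibreFamily P X hX

theorem tendsto_tensorMap_complMap {k : ℕ} (X : (n : ℕ) → Fin k → Matrix (Fin n) (Fin n) ℂ)
    (hX : ∀ a b c d, Tendsto
      (fun n : ℕ => (n : ℂ)⁻¹ * (X n a * (X n b)ᴴ * X n c * (X n d)ᴴ).trace) atTop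
      (𝓝 ((if a = b then 1 else 0) * (if c = d then 1 else 0) +
        (if a = d then 1 else 0) * (if b = c then 1 else 0)))) :
    Tendsto (fun n => tensorMap (complMap (X n)) (complMap (conjFam (X n)))
        (ketbra (bellState n))) atTop
      (𝓝 (((k : ℂ) ^ 2)⁻¹ • (1 : Matrix (Fin k × Fin k) (Fin k × Fin k) ℂ)
        + (k : ℂ)⁻¹ • ketbra (bellState k))) := by
  refine tendsto_pi_nhds.2 fun s => tendsto_pi_nhds.2 fun t => ?_
  simp only [tensorMap_complMap_bellState]
  have h := (hX s.1 s.2 t.2 t.1).const_mul ((k : ℂ) ^ 2)⁻¹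
  -- The pairing `s.1 = s.2`, `t.2 = t.1` gives the Bell projection, whose normalization supplies
  -- one factor `1 / k`; the pairing `s.1 = t.1`, `s.2 = t.2` gives the identity.
  convert! h using 2
  have hk : ((√(k : ℝ) : ℝ) : ℂ)⁻¹ * ((√(k : ℝ) : ℝ) : ℂ)⁻¹ = (k : ℂ)⁻¹ := by
    rw [← mul_inv, ← Complex.ofReal_mul, Real.mul_self_sqrt (Nat.cast_nonneg k),
      Complex.ofReal_natCast]
  have hb : ketbra (bellState k) s t =
      (k : ℂ)⁻¹ * ((if s.1 = s.2 then 1 else 0) * (if t.2 = t.1 then 1 else 0)) := by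
    rw [ketbra, Matrix.vecMulVec_apply, Pi.star_apply, bellState, bellState, ← hk]
    simp only [eq_comm (a := t.2)]
    split_ifs <;> simp
  have h1 : (1 : Matrix (Fin k × Fin k) (Fin k × Fin k) ℂ) s t =
      (if s.1 = t.1 then 1 else 0) * (if s.2 = t.2 then 1 else 0) := by
    simp only [Matrix.one_apply, Prod.ext_iff, ite_and]
    split_ifs <;> simp
  rw [Matrix.add_apply, Matrix.smul_apply, Matrix.smul_apply, hb, h1, smul_eq_mul, smul_eq_mul]
  ring

end Limit

theorem theorem3 {Ω : Type*} [MeasurableSpace Ω] (P : Measure Ω) [IsProbabilityMeasure P]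
    (k : ℕ) (hk : 0 < k) (X : (n : ℕ) → Fin k → Ω → Matrix (Fin n) (Fin n) ℂ)
    (hX : (∀ n, IsGUEFamily (X n) P) ∨ (∀ n, IsGinibreFamily (X n) P)) :
    ∀ᵐ ω ∂P,
      Tendsto
        (fun n => tensorMap (complMap fun i => X n i ω) (complMap (conjFam fun i => X n i ω))
          (ketbra (bellState n)))
        atTop
        (𝓝 (((k : ℂ) ^ 2)⁻¹ • (1 : Matrix (Fin k × Fin k) (Fin k × Fin k) ℂ)
          + (k : ℂ)⁻¹ • ketbra (bellState k))) ∧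
      (∀ p : ℝ≥0∞, 1 ≤ p →
        liminf (fun n => maxOutputNorm p
          (tensorMap (cpMap fun i => X n i ω) (cpMap (conjFam fun i => X n i ω)))) atTop =
        liminf (fun n => maxOutputNorm p
          (tensorMap (complMap fun i => X n i ω) (complMap (conjFam fun i => X n i ω)))) atTop) ∧
      (∀ p : ℝ, 1 ≤ p →
        ENNReal.ofReal
          (((1 / (k : ℝ) + 1 / (k : ℝ) ^ 2) ^ p
            + ((k : ℝ) ^ 2 - 1) * (1 / (k : ℝ) ^ 2) ^ p) ^ (1 / p)) ≤
        liminf (fun n => maxOutputNorm (ENNReal.ofReal p)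
          (tensorMap (cpMap fun i => X n i ω) (cpMap (conjFam fun i => X n i ω)))) atTop) ∧
      ENNReal.ofReal (1 / (k : ℝ) + 1 / (k : ℝ) ^ 2) ≤
        liminf (fun n => maxOutputNorm ∞
          (tensorMap (cpMap fun i => X n i ω) (cpMap (conjFam fun i => X n i ω)))) atTop := by
  filter_upwards [ae_tendsto_trace P X hX] with ω hω
  have hlim := tendsto_tensorMap_complMap (fun n i => X n i ω) hω
  have hbound := ofReal_norm_le_liminf_maxOutputNorm hk (fun n i => X n i ω) hlim
  -- Any index would do: it only says which column of the unitary is `b_k`.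
  let i : Fin k × Fin k := (⟨0, hk⟩, ⟨0, hk⟩)
  refine ⟨hlim, fun p hp => ?_, fun p hp => ?_, ?_⟩
  · simp only [maxOutputNorm_cpMap_eq_complMap p hp]
  · have h := hbound (ENNReal.ofReal p) (by simpa using ENNReal.ofReal_le_ofReal hp) i
    rw [norm_toLp_ite_const i (by positivity) (by positivity) hp] at h
    simpa [sq] using h
  · refine (ENNReal.ofReal_le_ofReal ?_).trans (hbound ∞ le_top i)
    have h := PiLp.norm_apply_le (WithLp.toLp ∞ fun j : Fin k × Fin k =>
      if j = i then 1 / (k : ℝ) + 1 / (k : ℝ) ^ 2 else 1 / (k : ℝ) ^ 2) i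
    simp only [if_true] at h
    exact (le_abs_self _).trans h
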